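/- Let $SU(1,1)\times\mathbb R$ be the group of matrices $$(A,B,v)=\begin{pmatrix}A&B&0\\ \overline B&\overline A&0\\0&0&e^v\end{pmatrix},\qquad A,B\in\mathbb C,\ |A|^2-|B|^2=1,\ v\in\mathbb R,$$ and let $E_1=\frac12(e_{12}+e_{21})$, $E_2=\frac i2(e_{12}-e_{21})$, $E_3=\frac i2(e_{11}-e_{22})$, $E_4=e_{33}$ be the basis of its Lie algebra. Let $d_1$, resp. $d_2$, be the left-invariant sub-Riemannian metric whose distribution is spanned by the orthonormal left-invariant frame $e_1=E_1$, $e_2=E_4-E_3$, $e_3=E_2$, resp. $e_1=E_1$, $e_2=E_4$, $e_3=E_2$, and put $e_4=-E_3$. For $i=1,2$, $\alpha=(\alpha_1,\alpha_2,\alpha_3)\in\mathbb S^2$ and $\beta\in\mathbb R$ let $\tilde\gamma_i(t)=\mathrm{Exp}_i(\alpha,\beta,t)$ be the normal geodesic of $d_i$, parametrized by arclength, with $\tilde\gamma_i(0)=\mathrm{Id}$ and initial momentum $\psi(0)=(\alpha_1,\alpha_2,\alpha_3,\psi_4(0))$ in the frame $e_1,\dots,e_4$, where $\psi_4(0)=-\alpha_2-\beta$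 if $i=1$ and $\psi_4(0)=-\beta$ if $i=2$; explicitly, $\tilde\gamma_i(t)=\exp(t(\alpha_1e_1+\alpha_2e_2+\alpha_3e_3+\beta e_4))\exp(-t\beta e_4)$. A time $t>0$ is conjugate along this geodesic if the differential at $(\alpha,\beta,t)$ of $\mathrm{Exp}_i:\mathbb S^2\times\mathbb R\times\mathbb R_+\to SU(1,1)\times\mathbb R$ is degenerate. If the geodesic has conjugate times, its first conjugate time is their infimum, and the point of the geodesic at this time is its first conjugate point if the time is positive. The first conjugate locus $\mathrm{Conj}^1_i$ is the set of all first conjugate points along the normal geodesics $\tilde\gamma_i$. Put $w_1=\sqrt{(\alpha_2+\beta)^2+\alpha_2^2-1}$ and $w_2=\sqrt{\beta^2+\alpha_2^2-1}$. Then for $i=1,2$: 1. Let $\alpha_2\ne\pm1$. If $w_i>0$ (that is, $w_i^2>0$), then the conjugate times along $\tilde\gamma_i$ form an increasing sequence $t^1_{\mathrm{conj}}<t^2_{\mathrm{conj}}<\cdots$ with $$t^{2m-1}_{\mathrm{conj}}=\frac{2\pi m}{w_i},\qquad t^{2m}_{\mathrm{conj}}=\frac{2x_m}{w_i},\qquad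 m=1,2,\dots,$$ where $x_1<x_2<\cdots$ are all the positive roots of the equation $\tan x=x$. If $w_i$ is zero or imaginary (that is, $w_i^2\le0$), then there are no conjugate times along $\tilde\gamma_i$. 2. $\mathrm{Conj}^1_i=\{(A,B,v)\in SU(1,1)\times\mathbb R : |A|=1,\ B=0,\ v\in\mathbb R\}$. -/

import Mathlib

open scoped ComplexConjugate

namespace SU11R

/-- Complex `3 × 3` matrices, the ambient space of the matrix group `SU(1,1) × ℝ`. -/
abbrev Mat : Type := Matrix (Fin 3) (Fin 3) ℂ

/-- The matrix denoted `(A, B, v)`. -/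
noncomputable def elt (A B : ℂ) (v : ℝ) : Mat :=
  !![A, B, 0; conj B, conj A, 0; 0, 0, (Real.exp v : ℂ)]

/-- The Lie group `SU(1,1) × ℝ`, realized as a closed matrix group. -/
def groupSU11R : Set Mat := {g | ∃ (A B : ℂ) (v : ℝ), ‖A‖ ^ 2 - ‖B‖ ^ 2 = 1 ∧ g = elt A B v}

/-- The basis element `E₁` of the basis `E₁, E₂, E₃, E₄` of the Lie algebra `su(1,1) ⊕ ℝ`. -/
noncomputable def E₁ : Mat := !![0, 1 / 2, 0; 1 / 2, 0, 0; 0, 0, 0]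

/-- The basis element `E₂`. -/
noncomputable def E₂ : Mat := !![0, Complex.I / 2, 0; -(Complex.I / 2), 0, 0; 0, 0, 0]

/-- The basis element `E₃`. -/
noncomputable def E₃ : Mat := !![Complex.I / 2, 0, 0; 0, -(Complex.I / 2), 0; 0, 0, 0]

/-- The basis element `E₄`. -/
noncomputable def E₄ : Mat := !![0, 0, 0; 0, 0, 0; 0, 0, 1]

/-- Labels for the two left-invariant sub-Riemannian metrics `d₁`, `d₂`. -/
inductive SRMetric : Type
  | d₁
  | d₂

/-- The basis `e₁, e₂, e₃, e₄` of the Lie algebra (indexed by `0, 1, 2, 3`) adapted to a metric: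
`e₁, e₂, e₃` is the orthonormal basis of the three-dimensional subspace that generates the
left-invariant distribution of the metric. -/
noncomputable def frame : SRMetric → Fin 4 → Mat
  | .d₁ => ![E₁, E₄ - E₃, E₂, -E₃]
  | .d₂ => ![E₁, E₄, E₂, -E₃]

/-- The coordinates of the brackets: `bracket i j l k` is the coefficient of `e_k` in
`[e_j, e_l]`. See `frame_bracket`. -/
noncomputable def bracket : SRMetric → Fin 4 → Fin 4 → Fin 4 → ℝ
  | .d₁ => ![![0, ![0, 0, 1, 0], ![0, 0, 0, 1], ![0, 0, 1, 0]],
             ![![0, 0, -1, 0], 0, ![1, 0, 0, 0], 0],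
             ![![0, 0, 0, -1], ![-1, 0, 0, 0], 0, ![-1, 0, 0, 0]],
             ![![0, 0, -1, 0], 0, ![1, 0, 0, 0], 0]]
  | .d₂ => ![![0, 0, ![0, 0, 0, 1], ![0, 0, 1, 0]],
             ![0, 0, 0, 0],
             ![![0, 0, 0, -1], 0, 0, ![-1, 0, 0, 0]],
             ![![0, 0, -1, 0], 0, ![1, 0, 0, 0], 0]]

/-- The commutation relations of the basis `E₁, E₂, E₃, E₄`. -/
theorem commutation_relations :
    E₁ * E₂ - E₂ * E₁ = -E₃ ∧ E₂ * E₃ - E₃ * E₂ = E₁ ∧ E₃ * E₁ - E₁ * E₃ = E₂ ∧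
      E₁ * E₄ - E₄ * E₁ = 0 ∧ E₂ * E₄ - E₄ * E₂ = 0 ∧ E₃ * E₄ - E₄ * E₃ = 0 := by
  have h : Complex.I * Complex.I = -1 := Complex.I_mul_I
  refine ⟨?_, ?_, ?_, ?_, ?_, ?_⟩ <;> ext p q <;> fin_cases p <;> fin_cases q <;>
    simp [E₁, E₂, E₃, E₄] <;> grind

/-- `bracket` really is the table of structure constants of the frame. -/
theorem frame_bracket (i : SRMetric) (j l : Fin 4) :
    frame i j * frame i l - frame i l * frame i j = ∑ k, bracket i j l k • frame i k := by
  obtain ⟨h12, h23, h31, h14, h24, h34⟩ := commutation_relations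
  cases i <;> fin_cases j <;> fin_cases l <;>
    simp [frame, bracket, Fin.sum_univ_four, mul_sub, sub_mul] <;> grind

/-- The initial value `ψ(0)` of the momentum for the parameters `α ∈ ℝ³`, `β ∈ ℝ`. -/
def initialMomentum : SRMetric → (Fin 3 → ℝ) → ℝ → Fin 4 → ℝ
  | .d₁, α, β => ![α 0, α 1, α 2, -α 1 - β]
  | .d₂, α, β => ![α 0, α 1, α 2, -β]

/-- `γ` is the normal geodesic of the sub-Riemannian metric `i` issuing from the identity with
parameters `(α, β)`: together with a momentum `ψ` it solves the left-trivialized normal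
Hamiltonian system `γ' = γ u`, `u = ψ₁ e₁ + ψ₂ e₂ + ψ₃ e₃`, `ψ_j' = ψ([u, e_j])`.
It has constant speed `|α|`, so it is parametrized by arclength when `|α| = 1`. -/
def IsNormalGeodesic (i : SRMetric) (α : Fin 3 → ℝ) (β : ℝ) (γ : ℝ → Mat) : Prop :=
  (∀ t, γ t ∈ groupSU11R) ∧ γ 0 = 1 ∧
  ∃ ψ : ℝ → Fin 4 → ℝ, ψ 0 = initialMomentum i α β ∧
    (∀ t, HasDerivAt γ (γ t * ∑ l : Fin 3, ψ t l.castSucc • frame i l.castSucc) t) ∧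
    (∀ t j, HasDerivAt (fun s => ψ s j)
      (∑ k : Fin 4, ∑ l : Fin 3, bracket i l.castSucc j k * ψ t l.castSucc * ψ t k) t)

/-- The product of two one-parameter subgroups
`exp(t(α₁e₁ + α₂e₂ + α₃e₃ + βe₄)) exp(-tβe₄)`. -/
noncomputable def expProduct (i : SRMetric) (α : Fin 3 → ℝ) (β t : ℝ) : Mat :=
  NormedSpace.exp
      (t • (α 0 • frame i 0 + α 1 • frame i 1 + α 2 • frame i 2 + β • frame i 3)) *
    NormedSpace.exp (-(t * β) • frame i 3)

section Existence

attribute [local instance] Matrix.linftyOpNormedRing Matrix.linftyOpNormedAlgebra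

/-- An automorphism of the matrix ring whose fixed points include the group `SU(1,1) × ℝ`. -/
noncomputable def sigma : Mat →+* Mat where
  toFun g := Matrix.of fun p q => conj (g (Equiv.swap 0 1 p) (Equiv.swap 0 1 q))
  map_one' := by
    ext p q
    by_cases h : p = q <;> simp [h, Matrix.one_apply]
  map_mul' g h := by
    ext p q
    simp only [Matrix.mul_apply, map_sum, map_mul, Matrix.of_apply]
    exact (Equiv.sum_comp (Equiv.swap (0 : Fin 3) 1)
      (fun r => conj (g (Equiv.swap 0 1 p) r) * conj (h r (Equiv.swap 0 1 q)))).symm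
  map_zero' := by ext p q; simp
  map_add' g h := by ext p q; simp

theorem continuous_sigma : Continuous sigma := by
  refine continuous_matrix fun p q => ?_
  exact Complex.continuous_conj.comp
    ((continuous_id (X := Mat)).matrix_elem (Equiv.swap 0 1 p) (Equiv.swap 0 1 q))

theorem hasDerivAt_entry {g : ℝ → Mat} {g' : Mat} {t : ℝ} (h : HasDerivAt g g' t)
    (p q : Fin 3) : HasDerivAt (fun s => g s p q) (g' p q) t :=
  ((Matrix.entryLinearMap ℝ ℂ p q).toContinuousLinearMap.hasFDerivAt
    (x := g t)).comp_hasDerivAt t h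

theorem hasDerivAt_of_entry {g : ℝ → Mat} {g' : Mat} {t : ℝ}
    (h : ∀ p q, HasDerivAt (fun s => g s p q) (g' p q) t) : HasDerivAt g g' t := by
  have : HasDerivAt (fun s => ∑ p, ∑ q, g s p q • (Matrix.single p q (1 : ℂ) : Mat))
      (∑ p, ∑ q, g' p q • (Matrix.single p q (1 : ℂ) : Mat)) t :=
    HasDerivAt.fun_sum fun p _ => HasDerivAt.fun_sum fun q _ => (h p q).smul_const _
  have e : ∀ m : Mat, ∑ p, ∑ q, m p q • (Matrix.single p q (1 : ℂ) : Mat) = m := by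
    intro m
    conv_rhs => rw [Matrix.matrix_eq_sum_single m]
    simp
  simpa only [e] using this

theorem one_mem_group : (1 : Mat) ∈ groupSU11R :=
  ⟨1, 0, 0, by simp, by ext p q; fin_cases p <;> fin_cases q <;> simp [elt]⟩

theorem mul_mem_group {g h : Mat} (hg : g ∈ groupSU11R) (hh : h ∈ groupSU11R) : g * h ∈ groupSU11R := by
  obtain ⟨A, B, v, h1, rfl⟩ := hg
  obtain ⟨A', B', v', h1', rfl⟩ := hh
  refine ⟨A * A' + B * conj B', A * B' + B * conj A', v + v', ?_, ?_⟩
  · rw [← Complex.ofReal_inj] at h1 h1' ⊢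
    push_cast at h1 h1' ⊢
    simp only [← Complex.mul_conj'] at h1 h1' ⊢
    simp only [map_add, map_mul, Complex.conj_conj]
    linear_combination (A' * conj A' - B' * conj B') * h1 + h1'
  · ext p q
    fin_cases p <;> fin_cases q <;>
      simp [elt, Matrix.mul_apply, Fin.sum_univ_three, Real.exp_add] <;> ring

/-- The general element of the Lie algebra. -/
noncomputable def alg (x y z w : ℝ) : Mat :=
  x • E₁ + y • E₂ + z • E₃ + w • E₄

theorem exp_mem_group (x y z w t : ℝ) :
    NormedSpace.exp (t • alg x y z w) ∈ groupSU11R := by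
  set X := alg x y z w with hX
  set g : ℝ → Mat := fun s => NormedSpace.exp (s • X) with hg
  have hI : Complex.I * Complex.I = -1 := Complex.I_mul_I
  have hder : ∀ s, HasDerivAt g (g s * X) s := fun s => hasDerivAt_exp_smul_const X s
  have h2 : conj (2 : ℂ) = 2 := map_ofNat _ 2
  have hsX : ∀ s : ℝ, sigma (s • X) = s • X := by
    intro s
    ext p q
    fin_cases p <;> fin_cases q <;>
      simp [sigma, hX, alg, E₁, E₂, E₃, E₄, Equiv.swap_apply_def, h2] <;> ring
  have hs : ∀ s, sigma (g s) = g s := by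
    intro s
    refine (NormedSpace.map_exp sigma continuous_sigma (s • X)).trans ?_
    rw [hsX]
    rfl
  have hc : ∀ s, E₄ * g s = g s * E₄ := by
    intro s
    have : Commute E₄ (s • X) := by
      refine Commute.smul_right ?_ s
      ext p q
      fin_cases p <;> fin_cases q <;>
        simp [hX, alg, E₁, E₂, E₃, E₄, Matrix.mul_apply, Fin.sum_univ_three]
    exact this.exp_right
  have e02 : ∀ s, g s 0 2 = 0 := fun s => by
    simpa [E₄, Matrix.mul_apply, Fin.sum_univ_three] using (congrFun₂ (hc s) 0 2).symm
  have e12 : ∀ s, g s 1 2 = 0 := fun s => by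
    simpa [E₄, Matrix.mul_apply, Fin.sum_univ_three] using (congrFun₂ (hc s) 1 2).symm
  have e20 : ∀ s, g s 2 0 = 0 := fun s => by
    simpa [E₄, Matrix.mul_apply, Fin.sum_univ_three] using (congrFun₂ (hc s) 2 0)
  have e21 : ∀ s, g s 2 1 = 0 := fun s => by
    simpa [E₄, Matrix.mul_apply, Fin.sum_univ_three] using (congrFun₂ (hc s) 2 1)
  have e10 : ∀ s, g s 1 0 = conj (g s 0 1) := fun s => by
    simpa [sigma, Equiv.swap_apply_def] using (congrFun₂ (hs s) 1 0).symm
  have e11 : ∀ s, g s 1 1 = conj (g s 0 0) := fun s => by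
    simpa [sigma, Equiv.swap_apply_def] using (congrFun₂ (hs s) 1 1).symm
  have e22 : ∀ s, conj (g s 2 2) = g s 2 2 := fun s => by
    simpa [sigma, Equiv.swap_apply_def] using (congrFun₂ (hs s) 2 2)
  have g0 : g 0 = 1 := by simp [hg]
  have hdet : ∀ s, g s 0 0 * g s 1 1 - g s 0 1 * g s 1 0 = 1 := by
    have hd : ∀ s, HasDerivAt (fun s => g s 0 0 * g s 1 1 - g s 0 1 * g s 1 0) 0 s := by
      intro s
      have := ((hasDerivAt_entry (hder s) 0 0).mul (hasDerivAt_entry (hder s) 1 1)).sub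
        ((hasDerivAt_entry (hder s) 0 1).mul (hasDerivAt_entry (hder s) 1 0))
      refine this.congr_deriv ?_
      simp only [Matrix.mul_apply, Fin.sum_univ_three, e02, e12]
      simp [hX, alg, E₁, E₂, E₃, E₄]
      ring
    intro s
    have := is_const_of_deriv_eq_zero (fun s => (hd s).differentiableAt)
      (fun s => (hd s).deriv) s 0
    simpa [g0] using this
  have hmul : g t = g (t / 2) * g (t / 2) := by
    simp only [hg]
    rw [← Matrix.exp_add_of_commute _ _ (Commute.refl _), ← add_smul, add_halves]
  have h22 : g t 2 2 = g (t / 2) 2 2 * g (t / 2) 2 2 := by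
    have := congrFun₂ hmul 2 2
    simpa [Matrix.mul_apply, Fin.sum_univ_three, e20, e21] using this
  obtain ⟨r, hr⟩ := Complex.conj_eq_iff_real.1 (e22 (t / 2))
  have hr0 : r ≠ 0 := by
    rintro rfl
    have hu : IsUnit (g (t / 2)) := Matrix.isUnit_exp _
    rw [Matrix.isUnit_iff_isUnit_det, Matrix.det_fin_three, hr, e20, e21] at hu
    simp at hu
  refine ⟨g t 0 0, g t 0 1, Real.log (r * r), ?_, ?_⟩
  · have := hdet t
    rw [e10, e11, Complex.mul_conj', Complex.mul_conj'] at this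
    exact_mod_cast this
  · rw [elt, Real.exp_log (mul_self_pos.2 hr0)]
    change g t = _
    ext p q
    fin_cases p <;> fin_cases q <;> simp [e02, e12, e20, e21, e10, e11, h22, hr]

/-- The solution of the momentum equation. -/
noncomputable def momentum (i : SRMetric) (α : Fin 3 → ℝ) (β t : ℝ) : Fin 4 → ℝ :=
  ![α 0 * Real.cos (β * t) + α 2 * Real.sin (β * t), α 1,
    -α 0 * Real.sin (β * t) + α 2 * Real.cos (β * t), initialMomentum i α β 3]

theorem momentum_hasDerivAt (i : SRMetric) (α : Fin 3 → ℝ) (β t : ℝ) (j : Fin 4) :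
    HasDerivAt (fun s => momentum i α β s j)
      (∑ k : Fin 4, ∑ l : Fin 3,
        bracket i l.castSucc j k * momentum i α β t l.castSucc * momentum i α β t k) t := by
  have hl : HasDerivAt (fun s : ℝ => β * s) β t := by
    simpa using (hasDerivAt_id t).const_mul β
  have h0 : HasDerivAt (fun s => α 0 * Real.cos (β * s) + α 2 * Real.sin (β * s))
      (α 0 * (-Real.sin (β * t) * β) + α 2 * (Real.cos (β * t) * β)) t :=
    (hl.cos.const_mul (α 0)).add (hl.sin.const_mul (α 2))
  have h2 : HasDerivAt (fun s => -α 0 * Real.sin (β * s) + α 2 * Real.cos (β * s))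
      (-α 0 * (Real.cos (β * t) * β) + α 2 * (-Real.sin (β * t) * β)) t :=
    (hl.sin.const_mul (-α 0)).add (hl.cos.const_mul (α 2))
  cases i <;> fin_cases j
  · exact h0.congr_deriv (by
      simp [momentum, initialMomentum, bracket, Fin.sum_univ_four, Fin.sum_univ_three]; ring)
  · exact (hasDerivAt_const t (α 1)).congr_deriv (by
      simp [momentum, initialMomentum, bracket, Fin.sum_univ_four, Fin.sum_univ_three]; ring)
  · exact h2.congr_deriv (by
      simp [momentum, initialMomentum, bracket, Fin.sum_univ_four, Fin.sum_univ_three]; ring)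
  · exact (hasDerivAt_const t _).congr_deriv (by
      simp [momentum, initialMomentum, bracket, Fin.sum_univ_four, Fin.sum_univ_three]; ring)
  · exact h0.congr_deriv (by
      simp [momentum, initialMomentum, bracket, Fin.sum_univ_four, Fin.sum_univ_three]; ring)
  · exact (hasDerivAt_const t (α 1)).congr_deriv (by
      simp [momentum, initialMomentum, bracket, Fin.sum_univ_four, Fin.sum_univ_three])
  · exact h2.congr_deriv (by
      simp [momentum, initialMomentum, bracket, Fin.sum_univ_four, Fin.sum_univ_three]; ring)
  · exact (hasDerivAt_const t _).congr_deriv (by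
      simp [momentum, initialMomentum, bracket, Fin.sum_univ_four, Fin.sum_univ_three]; ring)

theorem momentum_unique (i : SRMetric) (α : Fin 3 → ℝ) (β : ℝ) (ψ : ℝ → Fin 4 → ℝ)
    (h0 : ψ 0 = initialMomentum i α β)
    (h : ∀ t j, HasDerivAt (fun s => ψ s j)
      (∑ k : Fin 4, ∑ l : Fin 3, bracket i l.castSucc j k * ψ t l.castSucc * ψ t k) t) (t : ℝ) :
    ψ t = momentum i α β t := by
  have c1 : ∀ t, ψ t 1 = α 1 := by
    have hd : ∀ t, HasDerivAt (fun s => ψ s 1) 0 t := fun t => (h t 1).congr_deriv (by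
      cases i <;> simp [bracket, Fin.sum_univ_four, Fin.sum_univ_three] <;> ring)
    intro t
    have := is_const_of_deriv_eq_zero (fun s => (hd s).differentiableAt)
      (fun s => (hd s).deriv) t 0
    rw [this, h0]
    cases i <;> simp [initialMomentum]
  have c3 : ∀ t, ψ t 3 = initialMomentum i α β 3 := by
    have hd : ∀ t, HasDerivAt (fun s => ψ s 3) 0 t := fun t => (h t 3).congr_deriv (by
      cases i <;> simp [bracket, Fin.sum_univ_four, Fin.sum_univ_three] <;> ring)
    intro t
    have := is_const_of_deriv_eq_zero (fun s => (hd s).differentiableAt)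
      (fun s => (hd s).deriv) t 0
    rw [this, h0]
  have d0 : ∀ t, HasDerivAt (fun s => ψ s 0 - momentum i α β s 0)
      (β * (ψ t 2 - momentum i α β t 2)) t := fun t =>
    ((h t 0).sub (momentum_hasDerivAt i α β t 0)).congr_deriv (by
      cases i <;> simp [bracket, Fin.sum_univ_four, Fin.sum_univ_three, c1, c3, momentum,
        initialMomentum] <;> ring)
  have d2 : ∀ t, HasDerivAt (fun s => ψ s 2 - momentum i α β s 2)
      (-(β * (ψ t 0 - momentum i α β t 0))) t := fun t =>
    ((h t 2).sub (momentum_hasDerivAt i α β t 2)).congr_deriv (by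
      cases i <;> simp [bracket, Fin.sum_univ_four, Fin.sum_univ_three, c1, c3, momentum,
        initialMomentum] <;> ring)
  have hd : ∀ t, HasDerivAt (fun s => (ψ s 0 - momentum i α β s 0) ^ 2 +
      (ψ s 2 - momentum i α β s 2) ^ 2) 0 t := fun t =>
    (((d0 t).pow 2).add ((d2 t).pow 2)).congr_deriv (by push_cast; ring)
  have hz := is_const_of_deriv_eq_zero (fun s => (hd s).differentiableAt)
      (fun s => (hd s).deriv) t 0
  have hz' : (ψ t 0 - momentum i α β t 0) ^ 2 + (ψ t 2 - momentum i α β t 2) ^ 2 = 0 := by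
    rw [hz, h0]
    cases i <;> simp [momentum, initialMomentum]
  have e0 : ψ t 0 = momentum i α β t 0 := by nlinarith
  have e2 : ψ t 2 = momentum i α β t 2 := by nlinarith
  ext j
  fin_cases j
  · exact e0
  · exact c1 t
  · exact e2
  · exact c3 t

theorem exp_frame_three (i : SRMetric) (s : ℝ) :
    NormedSpace.exp (s • frame i 3) = Matrix.diagonal
      ![Complex.exp (-(s / 2 * Complex.I)), Complex.exp (s / 2 * Complex.I), 1] := by
  have : s • frame i 3 =
      Matrix.diagonal ![-(s / 2 * Complex.I), s / 2 * Complex.I, 0] := by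
    ext p q
    cases i <;> fin_cases p <;> fin_cases q <;> simp [frame, E₃] <;> ring
  rw [this, Matrix.exp_diagonal]
  congr 1
  ext p
  fin_cases p <;> simp [Complex.exp_eq_exp_ℂ]

/-- The velocity at time `t`, and its conjugate. -/
theorem velocity_conj (i : SRMetric) (α : Fin 3 → ℝ) (β t : ℝ) :
    NormedSpace.exp (-(t * β) • frame i 3) *
        ∑ l : Fin 3, momentum i α β t l.castSucc • frame i l.castSucc =
      (α 0 • frame i 0 + α 1 • frame i 1 + α 2 • frame i 2) *
        NormedSpace.exp (-(t * β) • frame i 3) := by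
  rw [exp_frame_three]
  have e1 : (((-(t * β) : ℝ) : ℂ) / 2 * Complex.I) = -((t * β / 2 : ℂ) * Complex.I) := by
    push_cast; ring
  rw [e1, neg_neg]
  have hc : ((Real.cos (β * t) : ℝ) : ℂ) =
      (Complex.exp (t * β / 2 * Complex.I) ^ 2 + Complex.exp (-(t * β / 2 * Complex.I)) ^ 2) / 2 := by
    rw [Complex.ofReal_cos, Complex.cos, ← Complex.exp_nat_mul, ← Complex.exp_nat_mul]
    push_cast
    ring_nf
  have hs : ((Real.sin (β * t) : ℝ) : ℂ) =
      (Complex.exp (-(t * β / 2 * Complex.I)) ^ 2 - Complex.exp (t * β / 2 * Complex.I) ^ 2) *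
        Complex.I / 2 := by
    rw [Complex.ofReal_sin, Complex.sin, ← Complex.exp_nat_mul, ← Complex.exp_nat_mul]
    push_cast
    ring_nf
  have hpq : Complex.exp (t * β / 2 * Complex.I) * Complex.exp (-(t * β / 2 * Complex.I)) = 1 := by
    rw [← Complex.exp_add, add_neg_cancel, Complex.exp_zero]
  have hI : Complex.I * Complex.I = -1 := Complex.I_mul_I
  generalize Complex.exp (t * β / 2 * Complex.I) = P at *
  generalize Complex.exp (-(t * β / 2 * Complex.I)) = Q at *
  rw [Fin.sum_univ_three]
  ext p q
  cases i <;> fin_cases p <;> fin_cases q <;>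
    simp [momentum, frame, E₁, E₂, E₃, E₄, -Complex.ofReal_cos, -Complex.ofReal_sin, hc, hs] <;>
    grind

theorem expProduct_mem (i : SRMetric) (α : Fin 3 → ℝ) (β t : ℝ) :
    expProduct i α β t ∈ groupSU11R := by
  refine mul_mem_group ?_ ?_
  · cases i
    · convert exp_mem_group (α 0) (α 2) (-α 1 - β) (α 1) t using 3
      simp [frame, alg, smul_sub, sub_smul]
      abel
    · convert exp_mem_group (α 0) (α 2) (-β) (α 1) t using 3
      simp [frame, alg]
      abel
  · convert exp_mem_group 0 0 (-1) 0 (-(t * β)) using 3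
    cases i <;> simp [frame, alg]

theorem hasDerivAt_fac₁ (i : SRMetric) (β t : ℝ) :
    HasDerivAt (fun t : ℝ => NormedSpace.exp (-(t * β) • frame i 3))
      (NormedSpace.exp (-(t * β) • frame i 3) * (-β • frame i 3)) t := by
  have h := hasDerivAt_exp_smul_const (𝕂 := ℝ) (-β • frame i 3) t
  simp only [smul_smul, mul_neg] at h
  exact h

theorem expProduct_isNormalGeodesic (i : SRMetric) (α : Fin 3 → ℝ) (β : ℝ) :
    IsNormalGeodesic i α β (expProduct i α β) := by
  refine ⟨expProduct_mem i α β, by simp [expProduct], momentum i α β, ?_, ?_,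
    momentum_hasDerivAt i α β⟩
  · ext j
    cases i <;> fin_cases j <;> simp [momentum, initialMomentum]
  · intro t
    set X := α 0 • frame i 0 + α 1 • frame i 1 + α 2 • frame i 2 + β • frame i 3 with hX
    have hP : HasDerivAt (fun t : ℝ => NormedSpace.exp (t • X)) (NormedSpace.exp (t • X) * X) t :=
      hasDerivAt_exp_smul_const X t
    have hQ := hasDerivAt_fac₁ i β t
    have h := hP.mul hQ
    refine h.congr_deriv ?_
    have hv := velocity_conj i α β t
    have hcomm : Commute (frame i 3) (NormedSpace.exp (-(t * β) • frame i 3)) :=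
      ((Commute.refl (frame i 3)).smul_right (-(t * β))).exp_right
    rw [expProduct, mul_assoc (NormedSpace.exp _) (NormedSpace.exp _), hv, ← hX, mul_assoc,
      ← mul_add]
    congr 1
    rw [hX, add_mul, mul_smul_comm, ← hcomm.eq, smul_mul_assoc]
    simp

/-- The normal geodesic with parameters `(α, β)` exists, is unique, and is a product of two
one-parameter subgroups. -/
theorem isNormalGeodesic_iff (i : SRMetric) (α : Fin 3 → ℝ) (β : ℝ) (γ : ℝ → Mat) :
    IsNormalGeodesic i α β γ ↔ γ = expProduct i α β := by
  refine ⟨?_, by rintro rfl; exact expProduct_isNormalGeodesic i α β⟩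
  rintro ⟨-, hγ0, ψ, hψ0, hγ, hψ⟩
  obtain rfl : ψ = momentum i α β := funext (momentum_unique i α β ψ hψ0 hψ)
  set X := α 0 • frame i 0 + α 1 • frame i 1 + α 2 • frame i 2 + β • frame i 3 with hX
  set Q : ℝ → Mat := fun t => NormedSpace.exp (-(t * β) • frame i 3) with hQ
  set R : ℝ → Mat := fun t => NormedSpace.exp ((t * β) • frame i 3) with hR
  set P : ℝ → Mat := fun t => NormedSpace.exp (t • X) with hP
  set S : ℝ → Mat := fun t => NormedSpace.exp (-t • X) with hS
  have hQR : ∀ t, Q t * R t = 1 := by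
    intro t
    simp only [hQ, hR]
    rw [← Matrix.exp_add_of_commute _ _
      (((Commute.refl _).smul_left _).smul_right _), ← add_smul]
    simp
  have hRQ : ∀ t, R t * Q t = 1 := fun t => mul_eq_one_comm.1 (hQR t)
  have hSP : ∀ t, S t * P t = 1 := by
    intro t
    simp only [hS, hP]
    rw [← Matrix.exp_add_of_commute _ _
      (((Commute.refl _).smul_left _).smul_right _), ← add_smul]
    simp
  have dR : ∀ t, HasDerivAt R (R t * (β • frame i 3)) t := fun t => by
    have h := hasDerivAt_exp_smul_const (𝕂 := ℝ) (β • frame i 3) t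
    simp only [smul_smul] at h
    exact h
  have dS : ∀ t, HasDerivAt S (-X * S t) t := fun t => by
    have h := hasDerivAt_exp_smul_const' (𝕂 := ℝ) (-X) t
    simp only [smul_neg, ← neg_smul] at h
    exact h
  have hd : ∀ t, HasDerivAt (fun t => γ t * R t * S t) 0 t := by
    intro t
    refine (((hγ t).mul (dR t)).mul (dS t)).congr_deriv ?_
    set u := ∑ l : Fin 3, momentum i α β t l.castSucc • frame i l.castSucc with hu
    have hv : Q t * u = (X - β • frame i 3) * Q t := by
      rw [hX, add_sub_cancel_right]
      exact velocity_conj i α β t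
    have hv' : u * R t = R t * (X - β • frame i 3) := by
      calc u * R t = R t * (Q t * u) * R t := by rw [← mul_assoc (R t), hRQ, one_mul]
        _ = R t * (X - β • frame i 3) * (Q t * R t) := by rw [hv]; simp only [mul_assoc]
        _ = _ := by rw [hQR, mul_one]
    rw [mul_assoc (γ t) u, hv']
    simp only [mul_sub, sub_mul, add_mul, neg_mul, mul_neg, mul_assoc, Pi.mul_apply]
    abel
  funext t
  have hK := is_const_of_deriv_eq_zero (fun s => (hd s).differentiableAt)
      (fun s => (hd s).deriv) t 0
  have hK' : γ t * R t * S t = 1 := by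
    rw [hK, hγ0]; simp [hR, hS]
  calc γ t = γ t * R t * (S t * P t) * Q t := by
        rw [hSP, mul_one, mul_assoc, hRQ, mul_one]
    _ = P t * Q t := by rw [← mul_assoc, hK', one_mul]
    _ = _ := rfl

end Existence

theorem existsUnique_normalGeodesic (i : SRMetric) (α : Fin 3 → ℝ) (β : ℝ) :
    ∃! γ : ℝ → Mat, IsNormalGeodesic i α β γ :=
  ⟨_, expProduct_isNormalGeodesic i α β, fun γ h => (isNormalGeodesic_iff i α β γ).1 h⟩

/-- The sub-Riemannian exponential map: `srExp i α β t` is the point at time `t` of the normal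
geodesic with parameters `(α, β)`. -/
noncomputable def srExp (i : SRMetric) (α : Fin 3 → ℝ) (β : ℝ) : ℝ → Mat :=
  (existsUnique_normalGeodesic i α β).choose

theorem srExp_eq (i : SRMetric) (α : Fin 3 → ℝ) (β : ℝ) : srExp i α β = expProduct i α β :=
  (isNormalGeodesic_iff i α β _).1 (existsUnique_normalGeodesic i α β).choose_spec.1

section Smoothness

attribute [local instance] Matrix.linftyOpNormedRing Matrix.linftyOpNormedAlgebra

/-- The exponential map is differentiable, so that its `fderiv` is its derivative. -/
theorem srExp_differentiable (i : SRMetric) :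
    Differentiable ℝ (fun p : (Fin 3 → ℝ) × ℝ × ℝ => srExp i p.1 p.2.1 p.2.2) := by
  have hexp : Differentiable ℝ (NormedSpace.exp : Mat → Mat) := fun x =>
    (NormedSpace.exp_analytic (𝕂 := ℝ) x).differentiableAt
  simp only [srExp_eq, expProduct]
  refine Differentiable.mul (hexp.comp ?_) (hexp.comp ?_) <;> fun_prop

end Smoothness

/-- The unit sphere `S²` in `ℝ³`: the parameters `α` of the geodesics parametrized by arclength. -/
def unitSphere : Set (Fin 3 → ℝ) := {α | α 0 ^ 2 + α 1 ^ 2 + α 2 ^ 2 = 1}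

/-- `t` is a conjugate time along the normal geodesic with parameters `(α, β) ∈ S² × ℝ`: `0 < t`
and the differential at `(α, β, t)` of the exponential map on the four-dimensional manifold
`S² × ℝ × ℝ₊` (with values in the four-dimensional group) has a nontrivial kernel. The tangent
space of `S² × ℝ × ℝ₊` at `(α, β, t)` consists of the vectors `(a, b, s)` with `a ⊥ α`, and the
differential is the restriction to it of the derivative of the smooth map
`(α, β, t) ↦ srExp i α β t` on `ℝ³ × ℝ × ℝ`. -/
def IsConjugateTime (i : SRMetric) (α : Fin 3 → ℝ) (β t : ℝ) : Prop :=
  0 < t ∧ ∃ (a : Fin 3 → ℝ) (b s : ℝ), (a, b, s) ≠ 0 ∧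
    a 0 * α 0 + a 1 * α 1 + a 2 * α 2 = 0 ∧
    fderiv ℝ (fun p : (Fin 3 → ℝ) × ℝ × ℝ => srExp i p.1 p.2.1 p.2.2) (α, β, t) (a, b, s) = 0

/-- The set of conjugate times along the normal geodesic with parameters `(α, β)`. -/
def conjugateTimes (i : SRMetric) (α : Fin 3 → ℝ) (β : ℝ) : Set ℝ :=
  {t | IsConjugateTime i α β t}

/-- The first conjugate locus: all points `γ(t₁)`, where `γ` is a normal geodesic parametrized by
arclength issuing from the identity, `t₁` is the infimum of its (existing) conjugate times, and
`t₁ > 0`. -/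
def firstConjugateLocus (i : SRMetric) : Set Mat :=
  {g | ∃ (α : Fin 3 → ℝ) (β t₁ : ℝ), α ∈ unitSphere ∧ IsGLB (conjugateTimes i α β) t₁ ∧ 0 < t₁ ∧
    g = srExp i α β t₁}

/-- The real number `w_i²`; it may be negative. -/
def wSq : SRMetric → (Fin 3 → ℝ) → ℝ → ℝ
  | .d₁, α, β => (α 1 + β) ^ 2 + α 1 ^ 2 - 1
  | .d₂, α, β => β ^ 2 + α 1 ^ 2 - 1

/-- `s 0 < s 1 < s 2 < ⋯` are precisely the elements of `S` in ascending order. -/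
def IsAscendingEnumeration (S : Set ℝ) (s : ℕ → ℝ) : Prop :=
  StrictMono s ∧ Set.range s = S

end SU11R

open SU11R

/-! The first exponential factor is explicit. Its generator is a traceless 2×2 block `X` with `X² =
-W/4`, together with a scalar entry. With `u = t²W/4`, `C(u) = cos √u`, `G(u) = sin √u / √u` and `S
= (t/2) G(u)`, the geodesic is `A = (C - icS) e^{itβ/2}`, `B = (α₁ + iα₃) S e^{-itβ/2}`, `v = tα₂`
(`srExp_eq_elt`). Here `c` is `spin`, the only quantity in which the two metrics differ. `C` and `G`
are entire in `u`, so the elliptic, parabolic and hyperbolic cases `W > 0`, `W = 0`, `W < 0` share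
one formula, and the identities `C' = -G/2`, `G + 2uG' = C`, `C² + uG² = 1` hold throughout.

For `α₂ ≠ ±1` the differential degenerates exactly when `G(u) = 0` or `G'(u) = 0`
(`isConjugateTime_iff`). If `G = 0`, rotating `(α₁, α₃)` does not move the endpoint. If `G' = 0`, a
variation of `β` is cancelled by such a rotation. Otherwise the linear system for the kernel reduces
to two equations whose determinant is a nonzero multiple of `|A|² = 1 + |B|² > 0`.

For `u ≤ 0` neither function vanishes, because `sinh y > 0` and `sinh y < y cosh y` for `y > 0`. For
`u = y²` with `y > 0` the conditions are `sin y = 0` and `tan y = y`. Their positive roots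
alternate, since each interval `(nπ, (n+1)π)` with `n ≥ 1` contains exactly one root of `tan y = y`
and `(0, π)` contains none. Hence the first conjugate time is `2π/w`. There `S = 0`, so `B = 0` and
`A = -e^{itβ/2}`; conversely, any prescribed `A` of modulus one and any `v` are reached by solving
for `α₂`, `β` and `w`. -/

namespace SU11R

/-! ### The entire functions `cos √u` and `sin √u / √u`. -/

/-- The entire function `C` with `C (z ^ 2) = cos z`. -/
noncomputable def cosSqrtC (u : ℂ) : ℂ := ∑' n : ℕ, (-u) ^ n / ((2 * n).factorial : ℂ)

theorem cosSqrtC_sq (z : ℂ) : cosSqrtC (z ^ 2) = Complex.cos z := by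
  rw [Complex.cos_eq_tsum, cosSqrtC]
  refine tsum_congr fun n => ?_
  rw [neg_pow, pow_mul]

theorem differentiable_cosSqrtC : Differentiable ℂ cosSqrtC := by
  intro u
  have h : DifferentiableOn ℂ cosSqrtC (Metric.ball 0 (‖u‖ + 1)) := by
    -- Weierstrass test on the ball of radius `R = ‖u‖ + 1`: since `n! ≤ (2n)!`, the terms are
    -- dominated by those of `exp R`.
    refine Complex.differentiableOn_tsum_of_summable_norm
      (Real.summable_pow_div_factorial (‖u‖ + 1)) (fun n => by fun_prop) Metric.isOpen_ball ?_
    intro n w hw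
    rw [norm_div, norm_pow, norm_neg, Complex.norm_natCast]
    have hw' : ‖w‖ ≤ ‖u‖ + 1 := by simpa using (mem_ball_zero_iff.1 hw).le
    have h1 : ((n.factorial : ℕ) : ℝ) ≤ ((2 * n).factorial : ℕ) := by
      exact_mod_cast Nat.factorial_le (by lia)
    gcongr
  exact (h u (by simp)).differentiableAt (Metric.isOpen_ball.mem_nhds (by simp))

/-- The entire function `G` with `z * G (z ^ 2) = sin z`. -/
noncomputable def sincSqrtC (u : ℂ) : ℂ := -2 * deriv cosSqrtC u

theorem differentiable_sincSqrtC : Differentiable ℂ sincSqrtC :=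
  (differentiable_cosSqrtC.deriv).const_mul _

/-- Differentiating `C(z²) = cos z` gives `2z C'(z²) = -sin z`; this is why the derivative of `C`
serves as the definition of `G`. -/
theorem mul_sincSqrtC_sq (z : ℂ) : z * sincSqrtC (z ^ 2) = Complex.sin z := by
  have h1 : HasDerivAt (fun z : ℂ => cosSqrtC (z ^ 2)) (deriv cosSqrtC (z ^ 2) * (2 * z)) z := by
    refine ((differentiable_cosSqrtC (z ^ 2)).hasDerivAt.comp z (hasDerivAt_pow 2 z)).congr_deriv ?_
    simp
  have h2 : HasDerivAt (fun z : ℂ => cosSqrtC (z ^ 2)) (-Complex.sin z) z := by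
    simpa only [cosSqrtC_sq] using Complex.hasDerivAt_cos z
  have := h1.unique h2
  rw [sincSqrtC]
  linear_combination -this

/-- This is the derivative of `z G(z²) = sin z`, read at a complex square root `z` of `u`. -/
theorem sincSqrtC_add (u : ℂ) : sincSqrtC u + 2 * u * deriv sincSqrtC u = cosSqrtC u := by
  obtain ⟨z, rfl⟩ : ∃ z : ℂ, z ^ 2 = u := IsAlgClosed.exists_pow_nat_eq u two_pos
  have h1 := (hasDerivAt_id z).mul
    ((differentiable_sincSqrtC (z ^ 2)).hasDerivAt.comp z (hasDerivAt_pow 2 z))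
  have h2 : HasDerivAt (fun z : ℂ => z * sincSqrtC (z ^ 2)) (Complex.cos z) z := by
    simpa only [mul_sincSqrtC_sq] using Complex.hasDerivAt_sin z
  have := h1.unique h2
  rw [cosSqrtC_sq, ← this]
  simp
  ring

theorem sincSqrtC_zero : sincSqrtC 0 = 1 := by
  have h := sincSqrtC_add 0
  have h2 := cosSqrtC_sq 0
  simp at h h2
  rw [h, h2]

/-- Differentiating `G + 2uG' = C` at `0` gives `3G'(0) = C'(0) = -G(0)/2`. -/
theorem deriv_sincSqrtC_zero : deriv sincSqrtC 0 = -1 / 6 := by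
  have h1 := (differentiable_sincSqrtC 0).hasDerivAt.add
    (((hasDerivAt_id (0 : ℂ)).const_mul 2).mul (differentiable_sincSqrtC.deriv 0).hasDerivAt)
  have h2 := (differentiable_cosSqrtC 0).hasDerivAt
  have e : (sincSqrtC + (fun y : ℂ => 2 * id y) * deriv sincSqrtC) = cosSqrtC :=
    funext fun u => sincSqrtC_add u
  have h3 := (e ▸ h1).unique h2
  have h4 : -2 * deriv cosSqrtC 0 = 1 := sincSqrtC_zero
  simp at h3
  linear_combination (1 / 3 : ℂ) * h3 - (1 / 6 : ℂ) * h4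

/-- The real function equal to `cos √u` for `0 ≤ u` and to `cosh √(-u)` for `u ≤ 0`. -/
noncomputable def cosSqrt (u : ℝ) : ℝ := (cosSqrtC u).re

/-- The real function equal to `sin √u / √u` for `0 < u` and to `sinh √(-u) / √(-u)` for
`u < 0`. -/
noncomputable def sincSqrt (u : ℝ) : ℝ := (sincSqrtC u).re

/-- The derivative of `sincSqrt`. -/
noncomputable def sincSqrt' (u : ℝ) : ℝ := (deriv sincSqrtC u).re

theorem hasDerivAt_cosSqrt (u : ℝ) : HasDerivAt cosSqrt (-sincSqrt u / 2) u := by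
  refine (differentiable_cosSqrtC u).hasDerivAt.real_of_complex.congr_deriv ?_
  simp [sincSqrt, sincSqrtC]

theorem hasDerivAt_sincSqrt (u : ℝ) : HasDerivAt sincSqrt (sincSqrt' u) u :=
  (differentiable_sincSqrtC u).hasDerivAt.real_of_complex

theorem sincSqrt_add (u : ℝ) : sincSqrt u + 2 * u * sincSqrt' u = cosSqrt u := by
  have := congrArg Complex.re (sincSqrtC_add u)
  rw [cosSqrt, sincSqrt, sincSqrt', ← this]
  simp

theorem sincSqrt_zero : sincSqrt 0 = 1 := by simp [sincSqrt, sincSqrtC_zero]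

theorem cosSqrt_zero : cosSqrt 0 = 1 := by simpa [sincSqrt_zero] using (sincSqrt_add 0).symm

theorem sincSqrt'_zero : sincSqrt' 0 = -1 / 6 := by
  simp [sincSqrt', deriv_sincSqrtC_zero]

/-- Unifies `cos² + sin² = 1` and `cosh² - sinh² = 1`: by `G + 2uG' = C` the left side has zero
derivative. -/
theorem cosSqrt_sq_add (u : ℝ) : cosSqrt u ^ 2 + u * sincSqrt u ^ 2 = 1 := by
  have hd : ∀ u, HasDerivAt (fun u => cosSqrt u ^ 2 + u * sincSqrt u ^ 2) 0 u := fun u =>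
    (((hasDerivAt_cosSqrt u).pow 2).add
      ((hasDerivAt_id u).mul ((hasDerivAt_sincSqrt u).pow 2))).congr_deriv (by
        simp [← sincSqrt_add u]; ring)
  have := is_const_of_deriv_eq_zero (fun s => (hd s).differentiableAt)
      (fun s => (hd s).deriv) u 0
  simpa [cosSqrt_zero] using this

theorem cosSqrt_sq (y : ℝ) : cosSqrt (y ^ 2) = Real.cos y := by
  rw [cosSqrt, Complex.ofReal_pow, cosSqrtC_sq, Complex.cos_ofReal_re]

theorem mul_sincSqrt_sq (y : ℝ) : y * sincSqrt (y ^ 2) = Real.sin y := by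
  rw [sincSqrt, Complex.ofReal_pow, ← Complex.re_ofReal_mul, mul_sincSqrtC_sq,
    Complex.sin_ofReal_re]

theorem cosSqrt_neg_sq (y : ℝ) : cosSqrt (-y ^ 2) = Real.cosh y := by
  have : ((-y ^ 2 : ℝ) : ℂ) = (y * Complex.I) ^ 2 := by simp [mul_pow]
  rw [cosSqrt, this, cosSqrtC_sq, Complex.cos_mul_I, Complex.cosh_ofReal_re]

theorem mul_sincSqrt_neg_sq (y : ℝ) : y * sincSqrt (-y ^ 2) = Real.sinh y := by
  have : ((-y ^ 2 : ℝ) : ℂ) = (y * Complex.I) ^ 2 := by simp [mul_pow]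
  have h := mul_sincSqrtC_sq (y * Complex.I)
  rw [← this, Complex.sin_mul_I, mul_right_comm] at h
  have h' := mul_right_cancel₀ Complex.I_ne_zero h
  rw [sincSqrt, ← Complex.re_ofReal_mul, h', Complex.sinh_ofReal_re]

theorem sincSqrt_eq_zero_iff {y : ℝ} (hy : 0 < y) : sincSqrt (y ^ 2) = 0 ↔ Real.sin y = 0 := by
  rw [← mul_sincSqrt_sq]
  simp [hy.ne']

/-- At `u = y²` the relation `G + 2uG' = C` becomes `2y³G' = y cos y - sin y`. -/
theorem sincSqrt'_eq_zero_iff {y : ℝ} (hy : 0 < y) :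
    sincSqrt' (y ^ 2) = 0 ↔ Real.sin y = y * Real.cos y := by
  have h := sincSqrt_add (y ^ 2)
  rw [cosSqrt_sq] at h
  rw [← mul_sincSqrt_sq, ← h]
  have := hy.ne'
  constructor
  · intro h; rw [h]; ring
  · intro h
    have : y ^ 3 * sincSqrt' (y ^ 2) = 0 := by linarith
    simpa [hy.ne'] using this

/-- The difference `x cosh x - sinh x` vanishes at `0` and has derivative `x sinh x`. This excludes
zeros of `G'` on the negative axis. -/
theorem sinh_lt_mul_cosh {y : ℝ} (hy : 0 < y) : Real.sinh y < y * Real.cosh y := by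
  have hd : ∀ x, HasDerivAt (fun x => x * Real.cosh x - Real.sinh x) (x * Real.sinh x) x :=
    fun x => (((hasDerivAt_id x).mul (Real.hasDerivAt_cosh x)).sub
      (Real.hasDerivAt_sinh x)).congr_deriv (by simp)
  have hm : StrictMonoOn (fun x => x * Real.cosh x - Real.sinh x) (Set.Ici 0) := by
    refine strictMonoOn_of_deriv_pos (convex_Ici 0)
      (fun x _ => (hd x).continuousAt.continuousWithinAt) fun x hx => ?_
    rw [interior_Ici] at hx
    rw [(hd x).deriv]
    exact mul_pos hx (Real.sinh_pos_iff.2 hx)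
  have := hm (Set.mem_Ici.2 le_rfl) (Set.mem_Ici.2 hy.le) hy
  simp at this
  exact this

theorem sincSqrt_ne_zero_of_nonpos {u : ℝ} (hu : u ≤ 0) : sincSqrt u ≠ 0 := by
  rcases hu.eq_or_lt with rfl | hu
  · simp [sincSqrt_zero]
  have hy : 0 < √(-u) := Real.sqrt_pos.2 (by linarith)
  have e : u = -√(-u) ^ 2 := by rw [Real.sq_sqrt (by linarith)]; ring
  intro h
  have := mul_sincSqrt_neg_sq √(-u)
  rw [← e, h, mul_zero] at this
  exact (Real.sinh_pos_iff.2 hy).ne this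

theorem sincSqrt'_ne_zero_of_nonpos {u : ℝ} (hu : u ≤ 0) : sincSqrt' u ≠ 0 := by
  rcases hu.eq_or_lt with rfl | hu
  · norm_num [sincSqrt'_zero]
  have hy : 0 < √(-u) := Real.sqrt_pos.2 (by linarith)
  have e : u = -√(-u) ^ 2 := by rw [Real.sq_sqrt (by linarith)]; ring
  intro h
  have h1 := mul_sincSqrt_neg_sq √(-u)
  have h2 := cosSqrt_neg_sq √(-u)
  have h3 := sincSqrt_add u
  rw [← e] at h1 h2
  have := sinh_lt_mul_cosh hy
  rw [← h1, ← h2, ← h3, h] at this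
  simp at this

/-! ### Closed form of the normal geodesics. -/

section ClosedForm

attribute [local instance] Matrix.linftyOpNormedRing Matrix.linftyOpNormedAlgebra

/-- The derivative of `elt A B v` for derivatives `A', B', v'` of its arguments. -/
noncomputable def eltDeriv (A' B' : ℂ) (v v' : ℝ) : Mat :=
  !![A', B', 0; conj B', conj A', 0; 0, 0, ((Real.exp v * v' : ℝ) : ℂ)]

theorem hasDerivAt_elt {A B : ℝ → ℂ} {v : ℝ → ℝ} {A' B' : ℂ} {v' t : ℝ}
    (hA : HasDerivAt A A' t) (hB : HasDerivAt B B' t) (hv : HasDerivAt v v' t) :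
    HasDerivAt (fun s => elt (A s) (B s) (v s)) (eltDeriv A' B' (v t) v') t := by
  have hA' : HasDerivAt (fun s => conj (A s)) (conj A') t := hA.star
  have hB' : HasDerivAt (fun s => conj (B s)) (conj B') t := hB.star
  have hv' : HasDerivAt (fun s => (Real.exp (v s) : ℂ)) ((Real.exp (v t) * v' : ℝ) : ℂ) t :=
    hv.exp.ofReal_comp
  refine hasDerivAt_of_entry fun p q => ?_
  fin_cases p <;> fin_cases q
  exacts [hA, hB, hasDerivAt_const _ _, hB', hA', hasDerivAt_const _ _, hasDerivAt_const _ _,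
    hasDerivAt_const _ _, hv']

theorem eltDeriv_eq_zero_iff {A' B' : ℂ} {v v' : ℝ} :
    eltDeriv A' B' v v' = 0 ↔ A' = 0 ∧ B' = 0 ∧ v' = 0 := by
  constructor
  · intro h
    have h1 : A' = 0 := congrFun₂ h 0 0
    have h2 : B' = 0 := congrFun₂ h 0 1
    have h3 : ((Real.exp v * v' : ℝ) : ℂ) = 0 := congrFun₂ h 2 2
    refine ⟨h1, h2, ?_⟩
    simpa [-Complex.ofReal_exp, Real.exp_ne_zero] using h3
  · rintro ⟨rfl, rfl, rfl⟩
    ext p q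
    fin_cases p <;> fin_cases q <;> simp [eltDeriv]

/-- A one-parameter subgroup is determined by its equation `Y' = Y X`. -/
theorem eq_exp_of_hasDerivAt {Y : ℝ → Mat} {X : Mat} (h0 : Y 0 = 1)
    (h : ∀ t, HasDerivAt Y (Y t * X) t) (t : ℝ) : NormedSpace.exp (t • X) = Y t := by
  set S : ℝ → Mat := fun t => NormedSpace.exp (-t • X) with hS
  have dS : ∀ t, HasDerivAt S (-X * S t) t := fun t => by
    have h := hasDerivAt_exp_smul_const' (𝕂 := ℝ) (-X) t
    simp only [smul_neg, ← neg_smul] at h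
    exact h
  have hSP : S t * NormedSpace.exp (t • X) = 1 := by
    simp only [hS]
    rw [← Matrix.exp_add_of_commute _ _
      (((Commute.refl _).smul_left _).smul_right _), ← add_smul]
    simp
  have hd : ∀ t, HasDerivAt (fun t => Y t * S t) 0 t := fun t =>
    ((h t).mul (dS t)).congr_deriv (by simp [mul_assoc])
  have hK := is_const_of_deriv_eq_zero (fun s => (hd s).differentiableAt)
      (fun s => (hd s).deriv) t 0
  have hK' : Y t * S t = 1 := by rw [hK, h0]; simp [hS]
  calc NormedSpace.exp (t • X) = Y t * S t * NormedSpace.exp (t • X) := by rw [hK', one_mul]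
    _ = Y t := by rw [mul_assoc, hSP, mul_one]

/-- Minus the coefficient of `E₃` in the generator of the first factor of `expProduct`. -/
def spin : SRMetric → (Fin 3 → ℝ) → ℝ → ℝ
  | .d₁, α, β => α 1 + β
  | .d₂, _, β => β

/-- An extension of `wSq` from the sphere to the ambient space. -/
def disc (i : SRMetric) (α : Fin 3 → ℝ) (β : ℝ) : ℝ := spin i α β ^ 2 - α 0 ^ 2 - α 2 ^ 2

/-- The derivative is taken in the ambient `ℝ³ × ℝ × ℝ`, so the closed form has to hold off the
sphere, where `disc` and `wSq` differ. -/
theorem disc_eq_wSq (i : SRMetric) {α : Fin 3 → ℝ} (hα : α ∈ unitSphere) (β : ℝ) :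
    disc i α β = wSq i α β := by
  have : α 0 ^ 2 + α 1 ^ 2 + α 2 ^ 2 = 1 := hα
  cases i <;> simp only [disc, wSq, spin] <;> linarith

/-- `sin (w t / 2) / w` with `w ^ 2 = W`. -/
noncomputable def sinQuot (W t : ℝ) : ℝ := t / 2 * sincSqrt (t ^ 2 * W / 4)

/-- The `A`-component of the normal geodesic. -/
noncomputable def compA (i : SRMetric) (α : Fin 3 → ℝ) (β t : ℝ) : ℂ :=
  (cosSqrt (t ^ 2 * disc i α β / 4) - spin i α β * sinQuot (disc i α β) t * Complex.I) *
    Complex.exp ((t * β / 2 : ℝ) * Complex.I)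

/-- The `B`-component of the normal geodesic. -/
noncomputable def compB (i : SRMetric) (α : Fin 3 → ℝ) (β t : ℝ) : ℂ :=
  (α 0 + α 2 * Complex.I) * sinQuot (disc i α β) t *
    Complex.exp (-((t * β / 2 : ℝ) * Complex.I))

theorem hasDerivAt_cosSqrt_time (W t : ℝ) :
    HasDerivAt (fun t => cosSqrt (t ^ 2 * W / 4)) (-(W * sinQuot W t) / 2) t := by
  have h : HasDerivAt (fun t : ℝ => t ^ 2 * W / 4) (t * W / 2) t :=
    (((hasDerivAt_pow 2 t).mul_const W).div_const 4).congr_deriv (by push_cast; ring)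
  exact ((hasDerivAt_cosSqrt _).comp t h).congr_deriv (by rw [sinQuot]; ring)

theorem hasDerivAt_sinQuot_time (W t : ℝ) :
    HasDerivAt (sinQuot W) (cosSqrt (t ^ 2 * W / 4) / 2) t := by
  have h : HasDerivAt (fun t : ℝ => t ^ 2 * W / 4) (t * W / 2) t :=
    (((hasDerivAt_pow 2 t).mul_const W).div_const 4).congr_deriv (by push_cast; ring)
  refine (((hasDerivAt_id t).div_const 2).mul ((hasDerivAt_sincSqrt _).comp t h)).congr_deriv ?_
  rw [← sincSqrt_add]
  simp
  ring

/-- The traceless block squares to `-disc/4`, so its exponential is `C + 2SX`. The check is that the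
right side solves `Y' = YX`, `Y(0) = 1`. -/
theorem exp_generator (i : SRMetric) (α : Fin 3 → ℝ) (β t : ℝ) :
    NormedSpace.exp
      (t • (α 0 • frame i 0 + α 1 • frame i 1 + α 2 • frame i 2 + β • frame i 3)) =
    elt (cosSqrt (t ^ 2 * disc i α β / 4) - spin i α β * sinQuot (disc i α β) t * Complex.I)
      ((α 0 + α 2 * Complex.I) * sinQuot (disc i α β) t) (t * α 1) := by
  refine eq_exp_of_hasDerivAt (Y := fun t => elt (cosSqrt (t ^ 2 * disc i α β / 4) -
      spin i α β * sinQuot (disc i α β) t * Complex.I)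
      ((α 0 + α 2 * Complex.I) * sinQuot (disc i α β) t) (t * α 1)) ?_ (fun t => ?_) t
  · ext p q
    fin_cases p <;> fin_cases q <;> simp [elt, sinQuot, cosSqrt_zero]
  · have hC := (hasDerivAt_cosSqrt_time (disc i α β) t).ofReal_comp
    have hS := (hasDerivAt_sinQuot_time (disc i α β) t).ofReal_comp
    refine (hasDerivAt_elt (hC.sub ((hS.const_mul _).mul_const _)) (hS.const_mul _)
      ((hasDerivAt_id t).mul_const _)).congr_deriv ?_
    have hI : Complex.I * Complex.I = -1 := Complex.I_mul_I
    have h2 : conj (2 : ℂ) = 2 := map_ofNat _ 2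
    have hW : (disc i α β : ℂ) = spin i α β ^ 2 - α 0 ^ 2 - α 2 ^ 2 := by simp [disc]
    have hX : α 0 • frame i 0 + α 1 • frame i 1 + α 2 • frame i 2 + β • frame i 3 =
        alg (α 0) (α 2) (-spin i α β) (α 1) := by
      cases i <;> simp [frame, alg, smul_sub, spin, add_smul] <;> abel
    rw [hX]
    ext p q
    fin_cases p <;> fin_cases q <;>
      simp [eltDeriv, elt, alg, E₁, E₂, E₃, E₄, Matrix.mul_apply, Fin.sum_univ_three, hW, h2] <;>
      grind

theorem srExp_eq_elt (i : SRMetric) (α : Fin 3 → ℝ) (β t : ℝ) :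
    srExp i α β t = elt (compA i α β t) (compB i α β t) (t * α 1) := by
  rw [srExp_eq, expProduct, exp_generator, exp_frame_three]
  have e1 : -(((-(t * β) : ℝ) : ℂ) / 2 * Complex.I) = (t * β / 2 : ℝ) * Complex.I := by
    push_cast; ring
  have e2 : (((-(t * β) : ℝ) : ℂ) / 2 * Complex.I) = -((t * β / 2 : ℝ) * Complex.I) := by
    push_cast; ring
  have e3 : conj (Complex.exp ((t * β / 2 : ℝ) * Complex.I)) =
      Complex.exp (-((t * β / 2 : ℝ) * Complex.I)) := by
    rw [← Complex.exp_conj, map_mul, Complex.conj_I, Complex.conj_ofReal, mul_neg]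
  have e4 : conj (Complex.exp (-((t * β / 2 : ℝ) * Complex.I))) =
      Complex.exp ((t * β / 2 : ℝ) * Complex.I) := by
    rw [← e3, Complex.conj_conj]
  rw [e1, e2]
  simp only [elt, compA, compB, map_mul, e3, e4]
  ext p q
  fin_cases p <;> fin_cases q <;> simp

end ClosedForm

/-! ### Differential of the exponential map. -/

section Differential

attribute [local instance] Matrix.linftyOpNormedRing Matrix.linftyOpNormedAlgebra

/-- The argument of `cosSqrt` and `sincSqrt` in the closed form of the geodesic. -/
noncomputable def phase (i : SRMetric) (α : Fin 3 → ℝ) (β t : ℝ) : ℝ := t ^ 2 * disc i α β / 4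

/-- The differential of `phase` in the direction `(a, b, s)`. -/
noncomputable def dPhase (i : SRMetric) (α : Fin 3 → ℝ) (β t : ℝ) (a : Fin 3 → ℝ) (b s : ℝ) : ℝ :=
  t * s * disc i α β / 2 +
    t ^ 2 * (spin i α β * spin i a b - α 0 * a 0 - α 2 * a 2) / 2

/-- The differential of `sinQuot` along the geodesic parameters in the direction `(a, b, s)`. -/
noncomputable def dSinQuot (i : SRMetric) (α : Fin 3 → ℝ) (β t : ℝ) (a : Fin 3 → ℝ)
    (b s : ℝ) : ℝ :=
  s / 2 * sincSqrt (phase i α β t) + t / 2 * sincSqrt' (phase i α β t) * dPhase i α β t a b s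

/-- The differential of the angle of the second factor of the geodesic. -/
noncomputable def dAngle (β t b s : ℝ) : ℝ := (s * β + t * b) / 2

variable (i : SRMetric) (α : Fin 3 → ℝ) (β t : ℝ) (a : Fin 3 → ℝ) (b s : ℝ)

/-- All directional derivatives are computed along the affine line `ε ↦ (α, β, t) + ε (a, b, s)`,
which leaves only one-variable calculus. -/
theorem hasDerivAt_line (x y : ℝ) : HasDerivAt (fun ε : ℝ => x + ε * y) y 0 := by
  simpa using ((hasDerivAt_id (0 : ℝ)).mul_const y).const_add x

theorem hasDerivAt_spin_line :
    HasDerivAt (fun ε : ℝ => spin i (α + ε • a) (β + ε * b)) (spin i a b) 0 := by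
  cases i
  · exact (hasDerivAt_line (α 1) (a 1)).add (hasDerivAt_line β b)
  · exact hasDerivAt_line β b

theorem hasDerivAt_phase_line :
    HasDerivAt (fun ε : ℝ => phase i (α + ε • a) (β + ε * b) (t + ε * s))
      (dPhase i α β t a b s) 0 := by
  refine (((((hasDerivAt_line t s).pow 2).mul ((((hasDerivAt_spin_line i α β a b).pow 2).sub
    ((hasDerivAt_line (α 0) (a 0)).pow 2)).sub
    ((hasDerivAt_line (α 2) (a 2)).pow 2))).div_const 4)).congr_deriv ?_
  simp [dPhase, disc]
  ring

theorem hasDerivAt_cosSqrt_line :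
    HasDerivAt (fun ε : ℝ => cosSqrt (phase i (α + ε • a) (β + ε * b) (t + ε * s)))
      (-sincSqrt (phase i α β t) / 2 * dPhase i α β t a b s) 0 := by
  refine ((hasDerivAt_cosSqrt _).comp 0 (hasDerivAt_phase_line i α β t a b s)).congr_deriv ?_
  simp

theorem hasDerivAt_sinQuot_line :
    HasDerivAt (fun ε : ℝ => sinQuot (disc i (α + ε • a) (β + ε * b)) (t + ε * s))
      (dSinQuot i α β t a b s) 0 := by
  have h1 := (hasDerivAt_sincSqrt _).comp 0 (hasDerivAt_phase_line i α β t a b s)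
  refine (((hasDerivAt_line t s).div_const 2).mul h1).congr_deriv ?_
  simp [dSinQuot]
  ring

theorem hasDerivAt_angle_line :
    HasDerivAt (fun ε : ℝ => (t + ε * s) * (β + ε * b) / 2) (dAngle β t b s) 0 := by
  refine (((hasDerivAt_line t s).mul (hasDerivAt_line β b)).div_const 2).congr_deriv ?_
  simp [dAngle]

/-- The exponential is kept as a common factor: being nonzero, it drops out when the derivative is
set to zero, leaving two real equations. -/
theorem hasDerivAt_compA_line :
    HasDerivAt (fun ε : ℝ => compA i (α + ε • a) (β + ε * b) (t + ε * s))
      ((((-sincSqrt (phase i α β t) / 2 * dPhase i α β t a b s +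
          spin i α β * sinQuot (disc i α β) t * dAngle β t b s : ℝ) : ℂ) +
        (cosSqrt (phase i α β t) * dAngle β t b s -
          (spin i a b * sinQuot (disc i α β) t + spin i α β * dSinQuot i α β t a b s) : ℝ) *
          Complex.I) * Complex.exp ((t * β / 2 : ℝ) * Complex.I)) 0 := by
  have hc := (hasDerivAt_cosSqrt_line i α β t a b s).ofReal_comp
  have hs := (hasDerivAt_sinQuot_line i α β t a b s).ofReal_comp
  have hp := (hasDerivAt_spin_line i α β a b).ofReal_comp
  have he := ((hasDerivAt_angle_line β t b s).ofReal_comp.mul_const Complex.I).cexp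
  refine ((hc.sub ((hp.mul hs).mul_const Complex.I)).mul he).congr_deriv ?_
  have hI : Complex.I * Complex.I = -1 := Complex.I_mul_I
  simp [-Complex.ofReal_mul, -Complex.ofReal_div, phase]
  push_cast
  linear_combination (-(spin i α β : ℂ) * sinQuot (disc i α β) t * dAngle β t b s *
    Complex.exp (t * β / 2 * Complex.I)) * hI

theorem hasDerivAt_compB_line :
    HasDerivAt (fun ε : ℝ => compB i (α + ε • a) (β + ε * b) (t + ε * s))
      ((((a 0 * sinQuot (disc i α β) t + α 0 * dSinQuot i α β t a b s +
          α 2 * sinQuot (disc i α β) t * dAngle β t b s : ℝ) : ℂ) +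
        (a 2 * sinQuot (disc i α β) t + α 2 * dSinQuot i α β t a b s -
          α 0 * sinQuot (disc i α β) t * dAngle β t b s : ℝ) *
          Complex.I) * Complex.exp (-((t * β / 2 : ℝ) * Complex.I))) 0 := by
  have hs := (hasDerivAt_sinQuot_line i α β t a b s).ofReal_comp
  have h0 := (hasDerivAt_line (α 0) (a 0)).ofReal_comp
  have h2 := (hasDerivAt_line (α 2) (a 2)).ofReal_comp
  have he := ((hasDerivAt_angle_line β t b s).ofReal_comp.mul_const Complex.I).neg.cexp
  refine (((h0.add (h2.mul_const Complex.I)).mul hs).mul he).congr_deriv ?_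
  have hI : Complex.I * Complex.I = -1 := Complex.I_mul_I
  simp [-Complex.ofReal_mul, -Complex.ofReal_div]
  push_cast
  linear_combination (-(α 2 : ℂ) * sinQuot (disc i α β) t * dAngle β t b s *
    Complex.exp (-(t * β / 2 * Complex.I))) * hI

theorem ofReal_add_mul_I_mul_exp_eq_zero_iff (x y : ℝ) (z : ℂ) :
    ((x : ℂ) + y * Complex.I) * Complex.exp z = 0 ↔ x = 0 ∧ y = 0 := by
  rw [mul_eq_zero, or_iff_left (Complex.exp_ne_zero z), Complex.ext_iff]
  simp

/-- The kernel of the differential of the exponential map. -/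
theorem fderiv_srExp_eq_zero_iff :
    fderiv ℝ (fun p : (Fin 3 → ℝ) × ℝ × ℝ => srExp i p.1 p.2.1 p.2.2) (α, β, t) (a, b, s) = 0 ↔
      (-sincSqrt (phase i α β t) / 2 * dPhase i α β t a b s +
          spin i α β * sinQuot (disc i α β) t * dAngle β t b s = 0 ∧
        cosSqrt (phase i α β t) * dAngle β t b s -
          (spin i a b * sinQuot (disc i α β) t + spin i α β * dSinQuot i α β t a b s) = 0) ∧
      (a 0 * sinQuot (disc i α β) t + α 0 * dSinQuot i α β t a b s +
          α 2 * sinQuot (disc i α β) t * dAngle β t b s = 0 ∧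
        a 2 * sinQuot (disc i α β) t + α 2 * dSinQuot i α β t a b s -
          α 0 * sinQuot (disc i α β) t * dAngle β t b s = 0) ∧
      s * α 1 + t * a 1 = 0 := by
  have hl : HasDerivAt (fun ε : ℝ => ((α + ε • a, β + ε * b, t + ε * s) : (Fin 3 → ℝ) × ℝ × ℝ))
      (a, b, s) 0 := by
    refine HasDerivAt.prodMk ?_ ((hasDerivAt_line β b).prodMk (hasDerivAt_line t s))
    simpa using ((hasDerivAt_id (0 : ℝ)).smul_const a).const_add α
  have hF : HasFDerivAt (fun p : (Fin 3 → ℝ) × ℝ × ℝ => srExp i p.1 p.2.1 p.2.2)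
      (fderiv ℝ (fun p : (Fin 3 → ℝ) × ℝ × ℝ => srExp i p.1 p.2.1 p.2.2) (α, β, t))
      (α + (0 : ℝ) • a, β + (0 : ℝ) * b, t + (0 : ℝ) * s) := by
    simpa using (srExp_differentiable i (α, β, t)).hasFDerivAt
  have h1 := hF.comp_hasDerivAt (0 : ℝ) hl
  have h2 : HasDerivAt (fun ε : ℝ => (t + ε * s) * (α 1 + ε * a 1)) (s * α 1 + t * a 1) 0 := by
    refine ((hasDerivAt_line t s).mul (hasDerivAt_line (α 1) (a 1))).congr_deriv ?_
    simp
  have h3 := hasDerivAt_elt (hasDerivAt_compA_line i α β t a b s)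
    (hasDerivAt_compB_line i α β t a b s) h2
  have h4 : ((fun p : (Fin 3 → ℝ) × ℝ × ℝ => srExp i p.1 p.2.1 p.2.2) ∘
      fun ε : ℝ => (α + ε • a, β + ε * b, t + ε * s)) =
      fun ε : ℝ => elt (compA i (α + ε • a) (β + ε * b) (t + ε * s))
        (compB i (α + ε • a) (β + ε * b) (t + ε * s)) ((t + ε * s) * (α 1 + ε * a 1)) :=
    funext fun ε => srExp_eq_elt _ _ _ _
  rw [h4] at h1
  -- The chain rule and the closed form compute the same derivative along the line.
  refine (Eq.congr (h1.unique h3) rfl).trans ?_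
  rw [eltDeriv_eq_zero_iff, ofReal_add_mul_I_mul_exp_eq_zero_iff,
    ofReal_add_mul_I_mul_exp_eq_zero_iff]

end Differential

/-! ### Conjugate times as zeros of `G` and `G'`. -/

section Conjugate

variable {i : SRMetric} {α : Fin 3 → ℝ} {β t : ℝ}

theorem isConjugateTime_of_sincSqrt_eq_zero (ht : 0 < t) (hα : α ∈ unitSphere) (h1 : α 1 ^ 2 ≠ 1)
    (h : sincSqrt (phase i α β t) = 0) : IsConjugateTime i α β t := by
  have hS : α 0 ^ 2 + α 1 ^ 2 + α 2 ^ 2 = 1 := hα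
  -- Infinitesimal rotation of `(α₁, α₃)`: it affects only `B`, where it is multiplied by `S = 0`.
  -- It is nonzero because `α₂² ≠ 1`.
  refine ⟨ht, ![-α 2, 0, α 0], 0, 0, fun h0 => h1 ?_, ?_, ?_⟩
  · have h0' := congrArg Prod.fst h0
    have e0 := congrFun h0' 0
    have e2 := congrFun h0' 2
    simp at e0 e2
    rw [e0, e2] at hS
    linarith
  · simp; ring
  · have hq : sinQuot (disc i α β) t = 0 := by
      rw [phase] at h; simp [sinQuot, h]
    have hp : spin i ![-α 2, 0, α 0] 0 = 0 := by cases i <;> simp [spin]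
    have hd : dPhase i α β t ![-α 2, 0, α 0] 0 0 = 0 := by
      simp [dPhase, hp]; right; ring
    rw [fderiv_srExp_eq_zero_iff]
    simp [hq, hp, hd, dSinQuot, dAngle]

theorem isConjugateTime_of_sincSqrt'_eq_zero (ht : 0 < t) (h : sincSqrt' (phase i α β t) = 0) :
    IsConjugateTime i α β t := by
  -- Varying `β` at unit rate turns the phase of `B` at rate `-t/2`; rotating `(α₁, α₃)` at rate
  -- `t/2` compensates. As `G' = 0`, `S` is stationary and `C = G`, which makes the variation of `A`
  -- vanish too.
  refine ⟨ht, ![-α 2 * t / 2, 0, α 0 * t / 2], 1, 0, fun h0 => ?_, ?_, ?_⟩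
  · simp at h0
  · simp; ring
  · have hc := sincSqrt_add (phase i α β t)
    rw [h] at hc
    have hp : spin i ![-α 2 * t / 2, 0, α 0 * t / 2] 1 = 1 := by cases i <;> simp [spin]
    have hq : sinQuot (disc i α β) t = t / 2 * sincSqrt (phase i α β t) := rfl
    rw [fderiv_srExp_eq_zero_iff]
    simp only [hq, ← hc, dSinQuot, h, dAngle, dPhase, hp]
    simp
    ring_nf
    simp

theorem sincSqrt_eq_zero_of_isConjugateTime (hα : α ∈ unitSphere) (h1 : α 1 ^ 2 ≠ 1)
    (h : IsConjugateTime i α β t) :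
    sincSqrt (phase i α β t) = 0 ∨ sincSqrt' (phase i α β t) = 0 := by
  obtain ⟨ht, a, b, s, hne, hT, hk⟩ := h
  rw [fderiv_srExp_eq_zero_iff] at hk
  obtain ⟨⟨k1, k2⟩, ⟨k3, k4⟩, k5⟩ := hk
  by_contra! hG
  obtain ⟨hG, hG'⟩ := hG
  apply hne
  have hS : α 0 ^ 2 + α 1 ^ 2 + α 2 ^ 2 = 1 := hα
  have hq : sinQuot (disc i α β) t = t / 2 * sincSqrt (phase i α β t) := rfl
  have hc := sincSqrt_add (phase i α β t)
  have hu : phase i α β t = t ^ 2 * disc i α β / 4 := rfl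
  have hpy := cosSqrt_sq_add (phase i α β t)
  -- Logarithmic time variation. The unknowns will be reduced to `σ` and `d = spin i a b`.
  obtain ⟨σ, hσ⟩ : ∃ σ, s = t * σ := ⟨s / t, by field_simp⟩
  have ha1 : a 1 = -α 1 * σ := by
    have : t * (a 1 + α 1 * σ) = 0 := by rw [hσ] at k5; linarith
    rcases mul_eq_zero.1 this with h | h <;> linarith
  have hτ : dAngle β t b s = t / 2 * (σ * spin i α β + spin i a b) := by
    cases i <;> simp only [dAngle, spin, hσ, ha1] <;> ring
  have hW : disc i α β = spin i α β ^ 2 - (1 - α 1 ^ 2) := by rw [disc]; linarith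
  have hdu : dPhase i α β t a b s =
      t ^ 2 / 2 * (σ * disc i α β + spin i α β * spin i a b - α 1 ^ 2 * σ) := by
    rw [dPhase, hσ]
    linear_combination (-t ^ 2 / 2) * hT + (t ^ 2 / 2 * α 1) * ha1
  have hb : spin i a b = 0 → σ = 0 → b = 0 := by
    intro h h'
    cases i
    · simp only [spin, ha1, h'] at h
      linarith
    · exact h
  have hdS : dSinQuot i α β t a b s = s / 2 * sincSqrt (phase i α β t) +
    t / 2 * sincSqrt' (phase i α β t) * dPhase i α β t a b s := rfl
  have hp : 0 < 1 - α 1 ^ 2 :=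
    lt_of_le_of_ne (by nlinarith [sq_nonneg (α 0), sq_nonneg (α 2)])
      fun h => h1 (by linarith)
  -- Component of the variation of `B` along `(α₁, α₃)`; tangency to the sphere eliminates `a 0` and
  -- `a 2`.
  have k6 : α 1 ^ 2 * σ * sinQuot (disc i α β) t + (1 - α 1 ^ 2) * dSinQuot i α β t a b s = 0 := by
    linear_combination α 0 * k3 + α 2 * k4 - sinQuot (disc i α β) t * hT
      + α 1 * sinQuot (disc i α β) t * ha1 - dSinQuot i α β t a b s * hS
  -- Once `σ = d = 0`, the variations of `S` and of the angle vanish, and the equations for `B`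
  -- become `a 0 * S = a 2 * S = 0` with `S ≠ 0`.
  suffices hz : σ = 0 ∧ spin i a b = 0 by
    obtain ⟨hs0, hd0⟩ := hz
    have hS0 : sinQuot (disc i α β) t ≠ 0 := by
      rw [hq]; exact mul_ne_zero (by positivity) hG
    have hdS0 : dSinQuot i α β t a b s = 0 := by
      rw [hdS, hdu, hσ, hs0, hd0]; ring
    rw [hτ, hdS0, hs0, hd0] at k3 k4
    simp [hS0] at k3 k4
    have e1 : a 1 = 0 := by rw [ha1, hs0]; ring
    have ea : a = 0 := by
      ext j; fin_cases j
      exacts [k3, e1, k4]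
    rw [ea, hb hd0 hs0, hσ, hs0, mul_zero]
    rfl
  rw [hτ] at k1 k2
  rw [hdS, hq, hdu, hσ] at k2 k6
  rw [hq, hdu] at k1
  rw [hu] at hc hpy hG hG' k1 k2 k6
  generalize sincSqrt (t ^ 2 * disc i α β / 4) = G at *
  generalize sincSqrt' (t ^ 2 * disc i α β / 4) = G' at *
  generalize cosSqrt (t ^ 2 * disc i α β / 4) = C at *
  rw [hW] at hc hpy k1 k2 k6
  generalize spin i a b = d at *
  generalize spin i α β = c at *
  generalize α 1 = p at *
  subst hc
  set W := c ^ 2 - (1 - p ^ 2) with hWdef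
  set C := G + 2 * (t ^ 2 * W / 4) * G' with hC
  have r1 : (t * C / 2 - p ^ 2 * c ^ 2 * (t ^ 3 * G' / 4)) * σ +
      (1 - p ^ 2) * c * (t ^ 3 * G' / 4) * d = 0 := by
    rw [← k6]; ring
  -- Angular component of the variation of `A`. Its radial component carries no new information,
  -- because `|A|² = 1 + |B|²`.
  have r2 : c * (t * (t / 2 * G) ^ 2 / 2 + p ^ 2 * C * (t ^ 3 * G' / 4)) * σ -
      (1 - p ^ 2) * C * (t ^ 3 * G' / 4) * d = 0 := by
    linear_combination C * k2 + c * (t / 2 * G) * k1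
  -- This is `|A|² = 1 + |B|²`; it is the factor left by Cramer's rule applied to `r1`, `r2`.
  have hA : C ^ 2 + c ^ 2 * (t / 2 * G) ^ 2 = 1 + (1 - p ^ 2) * (t / 2 * G) ^ 2 := by
    linear_combination hpy - (t / 2 * G) ^ 2 * hWdef
  have hA0 : 0 < C ^ 2 + c ^ 2 * (t / 2 * G) ^ 2 := by rw [hA]; positivity
  have hs0 : σ = 0 := by
    have : t / 2 * (C ^ 2 + c ^ 2 * (t / 2 * G) ^ 2) * σ = 0 := by
      linear_combination C * r1 + c * r2
    exact (mul_eq_zero.1 this).resolve_left (by positivity)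
  refine ⟨hs0, ?_⟩
  rw [hs0] at r1 r2
  have hQ : (1 - p ^ 2) * (t ^ 3 * G' / 4) ≠ 0 := by
    have := ht.ne'
    have := hp.ne'
    positivity
  have : (1 - p ^ 2) * (t ^ 3 * G' / 4) * ((C ^ 2 + c ^ 2 * (t / 2 * G) ^ 2) * d) = 0 := by
    linear_combination c * (t / 2 * G) ^ 2 * r1 - C * r2
  exact (mul_eq_zero.1 ((mul_eq_zero.1 this).resolve_left hQ)).resolve_left hA0.ne'

theorem isConjugateTime_iff (hα : α ∈ unitSphere) (h1 : α 1 ^ 2 ≠ 1) :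
    IsConjugateTime i α β t ↔
      0 < t ∧ (sincSqrt (phase i α β t) = 0 ∨ sincSqrt' (phase i α β t) = 0) :=
  ⟨fun h => ⟨h.1, sincSqrt_eq_zero_of_isConjugateTime hα h1 h⟩, fun ⟨ht, h⟩ =>
    h.elim (isConjugateTime_of_sincSqrt_eq_zero ht hα h1)
      (isConjugateTime_of_sincSqrt'_eq_zero ht)⟩

end Conjugate

/-! ### Positive roots of `tan x = x` and their interlacing with the zeros of the sine. -/

theorem tan_eq_self_iff {y : ℝ} (hy : 0 < y) :
    Real.tan y = y ↔ Real.sin y = y * Real.cos y := by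
  rw [Real.tan_eq_sin_div_cos]
  -- Where `cos y = 0`, `Real.tan y` is `0` by convention, so both sides are false.
  by_cases hc : Real.cos y = 0
  · have h1 := Real.sin_sq_add_cos_sq y
    have : Real.sin y ≠ 0 := fun h => by simp [h, hc] at h1
    simp [hc, hy.ne, this]
  · exact div_eq_iff hc

/-- Up to sign, `sin y - y cos y` at `y = n π + s`. -/
noncomputable def tanGap (n : ℕ) (s : ℝ) : ℝ := Real.sin s - (n * Real.pi + s) * Real.cos s

theorem sin_eq_mul_cos_iff (n : ℕ) (s : ℝ) :
    Real.sin (n * Real.pi + s) = (n * Real.pi + s) * Real.cos (n * Real.pi + s) ↔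
      tanGap n s = 0 := by
  have h1 : Real.sin (n * Real.pi + s) = (-1) ^ n * Real.sin s := by
    rw [add_comm, Real.sin_add_nat_mul_pi]
  have h2 : Real.cos (n * Real.pi + s) = (-1) ^ n * Real.cos s := by
    rw [add_comm, Real.cos_add_nat_mul_pi]
  rw [h1, h2, tanGap, mul_left_comm, sub_eq_zero]
  exact mul_right_inj' (by simp)

theorem hasDerivAt_tanGap (n : ℕ) (s : ℝ) :
    HasDerivAt (tanGap n) ((n * Real.pi + s) * Real.sin s) s :=
  ((Real.hasDerivAt_sin s).sub (((hasDerivAt_id s).const_add (n * Real.pi)).mul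
    (Real.hasDerivAt_cos s))).congr_deriv (by simp)

/-- Monotonicity allows at most one root per period; the derivative `(nπ + s) sin s` is positive
inside it. -/
theorem strictMonoOn_tanGap (n : ℕ) : StrictMonoOn (tanGap n) (Set.Icc 0 Real.pi) := by
  refine strictMonoOn_of_deriv_pos (convex_Icc _ _)
    (fun x _ => (hasDerivAt_tanGap n x).continuousAt.continuousWithinAt) fun x hx => ?_
  rw [interior_Icc] at hx
  rw [(hasDerivAt_tanGap n x).deriv]
  have h0 : 0 ≤ n * Real.pi := by positivity
  exact mul_pos (by linarith [hx.1]) (Real.sin_pos_of_pos_of_lt_pi hx.1 hx.2)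

/-- For index `n + 1` the end values are `-(n+1)π` and `(n+2)π`, of opposite sign. -/
theorem exists_tanGap_eq_zero (n : ℕ) :
    ∃ s ∈ Set.Ioo 0 Real.pi, tanGap (n + 1) s = 0 := by
  have hpi := Real.pi_pos
  refine intermediate_value_Ioo hpi.le
    (fun x _ => (hasDerivAt_tanGap (n + 1) x).continuousAt.continuousWithinAt) ⟨?_, ?_⟩
  · simp [tanGap]; positivity
  · simp [tanGap]; positivity

/-- The positive roots of `tan x = x`, in ascending order. -/
noncomputable def tanRoot (n : ℕ) : ℝ :=
  ((n + 1 : ℕ) : ℝ) * Real.pi + (exists_tanGap_eq_zero n).choose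

theorem lt_tanRoot (n : ℕ) : ((n : ℝ) + 1) * Real.pi < tanRoot n := by
  have := (exists_tanGap_eq_zero n).choose_spec.1.1
  simp only [tanRoot]
  push_cast
  linarith

theorem tanRoot_lt (n : ℕ) : tanRoot n < ((n : ℝ) + 1 + 1) * Real.pi := by
  have := (exists_tanGap_eq_zero n).choose_spec.1.2
  simp only [tanRoot]
  push_cast
  linarith

theorem tanRoot_pos (n : ℕ) : 0 < tanRoot n :=
  lt_of_le_of_lt (by positivity) (lt_tanRoot n)

theorem sin_tanRoot (n : ℕ) : Real.sin (tanRoot n) = tanRoot n * Real.cos (tanRoot n) :=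
  (sin_eq_mul_cos_iff _ _).2 (exists_tanGap_eq_zero n).choose_spec.2

theorem exists_eq_tanRoot {y : ℝ} (hy : 0 < y) (h : Real.sin y = y * Real.cos y) :
    ∃ n, tanRoot n = y := by
  have hpi := Real.pi_pos
  set n := ⌊y / Real.pi⌋₊ with hn
  have h1 : n * Real.pi ≤ y := (le_div_iff₀ hpi).1 (Nat.floor_le (by positivity))
  have h2 : y < (n + 1) * Real.pi := (div_lt_iff₀ hpi).1 (Nat.lt_floor_add_one _)
  obtain ⟨s, hs⟩ : ∃ s, y = n * Real.pi + s := ⟨y - n * Real.pi, by ring⟩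
  have hs0 : 0 ≤ s := by linarith
  have hs1 : s < Real.pi := by linarith
  have h' := (sin_eq_mul_cos_iff n s).1 (hs ▸ h)
  clear_value n
  rcases n with _ | n
  -- No root lies in `(0, π)`: there `tanGap 0` increases strictly from `tanGap 0 0 = 0`.
  · have hs' : 0 < s := by simpa [hs] using hy
    have := strictMonoOn_tanGap 0 ⟨le_rfl, hpi.le⟩ ⟨hs0, hs1.le⟩ hs'
    rw [h'] at this
    simp [tanGap] at this
  · refine ⟨n, ?_⟩
    obtain ⟨hc, hc'⟩ := (exists_tanGap_eq_zero n).choose_spec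
    have := (strictMonoOn_tanGap (n + 1)).injOn ⟨hc.1.le, hc.2.le⟩ ⟨hs0, hs1.le⟩ (hc'.trans h'.symm)
    rw [tanRoot, this, hs]

theorem isAscendingEnumeration_tanRoot :
    IsAscendingEnumeration {y : ℝ | 0 < y ∧ Real.tan y = y} tanRoot := by
  refine ⟨strictMono_nat_of_lt_succ fun n => (tanRoot_lt n).trans ?_, ?_⟩
  · simpa using lt_tanRoot (n + 1)
  · ext y
    constructor
    · rintro ⟨n, rfl⟩
      exact ⟨tanRoot_pos n, (tan_eq_self_iff (tanRoot_pos n)).2 (sin_tanRoot n)⟩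
    · rintro ⟨hy, h⟩
      exact exists_eq_tanRoot hy ((tan_eq_self_iff hy).1 h)

theorem sin_eq_zero_iff_of_pos {y : ℝ} (hy : 0 < y) :
    Real.sin y = 0 ↔ ∃ n : ℕ, y = (n + 1) * Real.pi := by
  constructor
  · intro h
    obtain ⟨k, hk⟩ := Real.sin_eq_zero_iff.1 h
    have hk0 : 0 < k := by
      have : (0 : ℝ) < k := by
        by_contra! h0
        nlinarith [Real.pi_pos]
      exact_mod_cast this
    lift k to ℕ using hk0.le
    obtain ⟨n, rfl⟩ : ∃ n, k = n + 1 := ⟨k - 1, by lia⟩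
    exact ⟨n, by rw [← hk]; push_cast; ring⟩
  · rintro ⟨n, rfl⟩
    exact_mod_cast Real.sin_nat_mul_pi (n + 1)

/-- The positive zeros of `sin y` and `sin y - y cos y` alternate. -/
noncomputable def alternatingRoot (k : ℕ) : ℝ :=
  if Even k then ((k / 2 : ℕ) + 1) * Real.pi else tanRoot (k / 2)

theorem alternatingRoot_two_mul (m : ℕ) : alternatingRoot (2 * m) = (m + 1) * Real.pi := by
  simp [alternatingRoot]

theorem alternatingRoot_two_mul_add_one (m : ℕ) : alternatingRoot (2 * m + 1) = tanRoot m := by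
  simp [alternatingRoot, show (2 * m + 1) / 2 = m by lia]

theorem isAscendingEnumeration_alternatingRoot :
    IsAscendingEnumeration {y : ℝ | 0 < y ∧ (Real.sin y = 0 ∨ Real.sin y = y * Real.cos y)}
      alternatingRoot := by
  refine ⟨strictMono_nat_of_lt_succ fun k => ?_, ?_⟩
  · obtain ⟨m, rfl | rfl⟩ := k.even_or_odd'
    · rw [alternatingRoot_two_mul, alternatingRoot_two_mul_add_one]
      exact lt_tanRoot m
    · rw [alternatingRoot_two_mul_add_one, show 2 * m + 1 + 1 = 2 * (m + 1) by ring,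
        alternatingRoot_two_mul]
      simpa using tanRoot_lt m
  · ext y
    constructor
    · rintro ⟨k, rfl⟩
      obtain ⟨m, rfl | rfl⟩ := k.even_or_odd'
      · rw [alternatingRoot_two_mul]
        have : 0 < (m + 1) * Real.pi := by positivity
        exact ⟨this, Or.inl ((sin_eq_zero_iff_of_pos this).2 ⟨m, rfl⟩)⟩
      · rw [alternatingRoot_two_mul_add_one]
        exact ⟨tanRoot_pos m, Or.inr (sin_tanRoot m)⟩
    · rintro ⟨hy, h | h⟩
      · obtain ⟨m, rfl⟩ := (sin_eq_zero_iff_of_pos hy).1 h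
        exact ⟨2 * m, alternatingRoot_two_mul m⟩
      · obtain ⟨m, rfl⟩ := exists_eq_tanRoot hy h
        exact ⟨2 * m + 1, alternatingRoot_two_mul_add_one m⟩

/-! ### Enumeration of the conjugate times and the first conjugate locus. -/

section Locus

variable {i : SRMetric} {α : Fin 3 → ℝ} {β : ℝ}

theorem conjugateTimes_eq_empty (hα : α ∈ unitSphere) (h1 : α 1 ^ 2 ≠ 1) (hw : wSq i α β ≤ 0) :
    conjugateTimes i α β = ∅ := by
  ext t
  simp only [conjugateTimes, Set.mem_ofPred_eq, isConjugateTime_iff hα h1,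
    Set.mem_empty_iff_false, iff_false]
  rintro ⟨-, h⟩
  have hu : phase i α β t ≤ 0 := by
    rw [phase, disc_eq_wSq i hα]
    nlinarith [mul_nonneg (sq_nonneg t) (neg_nonneg.2 hw)]
  exact h.elim (sincSqrt_ne_zero_of_nonpos hu) (sincSqrt'_ne_zero_of_nonpos hu)

theorem phase_eq_sq (hα : α ∈ unitSphere) (hw : 0 ≤ wSq i α β) (t : ℝ) :
    phase i α β t = (t * √(wSq i α β) / 2) ^ 2 := by
  rw [phase, disc_eq_wSq i hα, div_pow, mul_pow, Real.sq_sqrt hw]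
  norm_num

theorem isAscendingEnumeration_conjugateTimes (hα : α ∈ unitSphere) (h1 : α 1 ^ 2 ≠ 1)
    (hw : 0 < wSq i α β) :
    IsAscendingEnumeration (conjugateTimes i α β)
      fun k => 2 * alternatingRoot k / √(wSq i α β) := by
  have hw' : 0 < √(wSq i α β) := Real.sqrt_pos.2 hw
  obtain ⟨hm, hr⟩ := isAscendingEnumeration_alternatingRoot
  refine ⟨fun j k hjk => ?_, ?_⟩
  · have := hm hjk
    dsimp only
    gcongr
  · ext t
    -- The substitution `y = t w / 2` turns `phase` into `y²`.
    have key : t ∈ conjugateTimes i α β ↔ t * √(wSq i α β) / 2 ∈ Set.range alternatingRoot := by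
      rw [hr]
      simp only [conjugateTimes, Set.mem_ofPred_eq, isConjugateTime_iff hα h1,
        phase_eq_sq hα hw.le]
      have ht : 0 < t ↔ 0 < t * √(wSq i α β) / 2 := by
        constructor
        · intro h; positivity
        · intro h
          exact (mul_pos_iff_of_pos_right hw').1 (by linarith)
      rw [ht]
      refine and_congr_right fun hy => ?_
      rw [sincSqrt_eq_zero_iff hy, sincSqrt'_eq_zero_iff hy]
    rw [key]
    refine exists_congr fun k => ?_
    rw [div_eq_iff hw'.ne', eq_div_iff two_ne_zero]
    constructor <;> intro h <;> linarith

theorem isLeast_conjugateTimes (hα : α ∈ unitSphere) (h1 : α 1 ^ 2 ≠ 1) (hw : 0 < wSq i α β) :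
    IsLeast (conjugateTimes i α β) (2 * Real.pi / √(wSq i α β)) := by
  obtain ⟨hm, hr⟩ := isAscendingEnumeration_conjugateTimes hα h1 hw
  have h0 : 2 * alternatingRoot 0 / √(wSq i α β) = 2 * Real.pi / √(wSq i α β) := by
    simpa using congrArg (fun x => 2 * x / √(wSq i α β)) (alternatingRoot_two_mul 0)
  rw [← h0, ← hr]
  refine ⟨⟨0, rfl⟩, ?_⟩
  rintro _ ⟨k, rfl⟩
  exact hm.monotone k.zero_le

theorem sphere_coord_eq_zero (hα : α ∈ unitSphere) (h1 : α 1 ^ 2 = 1) : α 0 = 0 ∧ α 2 = 0 := by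
  have hS : α 0 ^ 2 + α 1 ^ 2 + α 2 ^ 2 = 1 := hα
  constructor <;> nlinarith

theorem srExp_mem_group (t : ℝ) : srExp i α β t ∈ groupSU11R := by
  rw [srExp_eq]
  exact expProduct_mem i α β t

theorem norm_eq_one_of_elt_zero_mem {A : ℂ} {v : ℝ} (h : elt A 0 v ∈ groupSU11R) : ‖A‖ = 1 := by
  obtain ⟨A', B', v', h1, h2⟩ := h
  have hA : A = A' := congrFun₂ h2 0 0
  have hB : 0 = B' := congrFun₂ h2 0 1
  rw [← hA, ← hB] at h1
  have h3 : ‖A‖ ^ 2 = 1 := by simpa using h1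
  exact (pow_eq_one_iff_of_nonneg (norm_nonneg A) two_ne_zero).1 h3

theorem srExp_of_compB_eq_zero {t : ℝ} (h : compB i α β t = 0) :
    srExp i α β t ∈ {g ∈ groupSU11R | ∃ (A : ℂ) (v : ℝ), ‖A‖ = 1 ∧ g = elt A 0 v} := by
  have hg := srExp_mem_group (i := i) (α := α) (β := β) t
  have e := srExp_eq_elt i α β t
  rw [h] at e
  refine ⟨hg, _, _, ?_, e⟩
  rw [e] at hg
  exact norm_eq_one_of_elt_zero_mem hg

theorem phase_first (hα : α ∈ unitSphere) (hw : 0 < wSq i α β) :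
    phase i α β (2 * Real.pi / √(wSq i α β)) = Real.pi ^ 2 := by
  have hw' : √(wSq i α β) ≠ 0 := (Real.sqrt_pos.2 hw).ne'
  rw [phase_eq_sq hα hw.le]
  field_simp

theorem sinQuot_first (hα : α ∈ unitSphere) (hw : 0 < wSq i α β) :
    sinQuot (disc i α β) (2 * Real.pi / √(wSq i α β)) = 0 := by
  have h := phase_first hα hw
  rw [phase] at h
  rw [sinQuot, h, (sincSqrt_eq_zero_iff Real.pi_pos).2 Real.sin_pi, mul_zero]

theorem firstConjugateLocus_subset (i : SRMetric) :
    firstConjugateLocus i ⊆ {g ∈ groupSU11R | ∃ (A : ℂ) (v : ℝ), ‖A‖ = 1 ∧ g = elt A 0 v} := by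
  rintro _ ⟨α, β, t, hα, hglb, ht, rfl⟩
  apply srExp_of_compB_eq_zero
  -- For `α₂ = ±1` the component `B` vanishes identically, so the conjugate times need not be known.
  by_cases h1 : α 1 ^ 2 = 1
  · obtain ⟨h0, h2⟩ := sphere_coord_eq_zero hα h1
    simp [compB, h0, h2]
  · rcases le_or_gt (wSq i α β) 0 with hw | hw
    · rw [conjugateTimes_eq_empty hα h1 hw, isGLB_empty_iff] at hglb
      exact absurd (hglb (t + 1)) (by simp)
    · rw [hglb.unique (isLeast_conjugateTimes hα h1 hw).isGLB, compB, sinQuot_first hα hw]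
      simp

theorem exists_angle (A : ℂ) (hA : ‖A‖ = 1) : ∃ θ : ℝ, Real.pi < θ ∧
    A = -Complex.exp (θ * Complex.I) := by
  -- An odd multiple of `π` produces the minus sign, and `5π` is large enough since `arg A > -π`.
  refine ⟨A.arg + 5 * Real.pi, by linarith [Complex.neg_pi_lt_arg A, Real.pi_pos], ?_⟩
  have h := Complex.norm_mul_exp_arg_mul_I A
  rw [hA, Complex.ofReal_one, one_mul] at h
  have : ((A.arg + 5 * Real.pi : ℝ) : ℂ) * Complex.I =
      A.arg * Complex.I + Real.pi * Complex.I + 2 * (2 * Real.pi * Complex.I) := by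
    push_cast; ring
  rw [this, Complex.exp_add, Complex.exp_add, h, Complex.exp_pi_mul_I]
  have : Complex.exp (2 * (2 * Real.pi * Complex.I)) = 1 := by
    simpa using Complex.exp_nat_mul_two_pi_mul_I 2
  rw [this]; ring

/-- The correction to the angle of `A` caused by the choice of `e₂`. -/
noncomputable def angleShift : SRMetric → ℝ → ℝ
  | .d₁, v => v / 2
  | .d₂, _ => 0

theorem subset_firstConjugateLocus (i : SRMetric) :
    {g ∈ groupSU11R | ∃ (A : ℂ) (v : ℝ), ‖A‖ = 1 ∧ g = elt A 0 v} ⊆ firstConjugateLocus i := by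
  rintro _ ⟨-, A, v, hA, rfl⟩
  have hpi := Real.pi_pos
  obtain ⟨θ, hθ, hθA⟩ := exists_angle (A * Complex.exp (angleShift i v * Complex.I))
    (by rw [norm_mul, hA, Complex.norm_exp_ofReal_mul_I, one_mul])
  have hD : 0 < θ ^ 2 + v ^ 2 / 4 - Real.pi ^ 2 := by nlinarith [sq_nonneg v]
  -- With `t = 2π/w`, the requirements `tc/2 = θ` and `tα₂ = v` give `c = θw/π` and `α₂ = vw/(2π)`;
  -- inserting these in `w² = c² + α₂² - 1` determines `w`. The choice `θ > π` makes the radicand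
  -- positive.
  set w : ℝ := Real.pi / √(θ ^ 2 + v ^ 2 / 4 - Real.pi ^ 2) with hw
  have hw0 : 0 < w := div_pos hpi (Real.sqrt_pos.2 hD)
  have hw2 : w ^ 2 * (θ ^ 2 + v ^ 2 / 4 - Real.pi ^ 2) = Real.pi ^ 2 := by
    rw [hw, div_pow, Real.sq_sqrt hD.le, div_mul_cancel₀ _ hD.ne']
  set p : ℝ := v * w / (2 * Real.pi) with hp
  set c : ℝ := θ * w / Real.pi with hc
  have hwc : c ^ 2 + p ^ 2 - 1 = w ^ 2 := by
    rw [hp, hc]; field_simp; linear_combination 4 * hw2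
  have hp1 : p ^ 2 < 1 := by
    -- Again from `θ > π`; then `p² = 1 - (c² - w²) < 1`, so `p` is an admissible `α₂ ≠ ±1`.
    have h1 : w ^ 2 < c ^ 2 := by
      refine pow_lt_pow_left₀ ?_ hw0.le two_ne_zero
      rw [hc, lt_div_iff₀ hpi, mul_comm]
      gcongr
    linarith
  set α : Fin 3 → ℝ := ![√(1 - p ^ 2), p, 0] with hαdef
  have hα : α ∈ unitSphere := by
    have : √(1 - p ^ 2) ^ 2 = 1 - p ^ 2 := Real.sq_sqrt (by linarith)
    simp [unitSphere, hαdef, this]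
  -- For `d₁`, `β = c - p`, hence `tβ/2 = θ - v/2`; this is the origin of `angleShift`. For `d₂`, `β
  -- = c`.
  obtain ⟨β, hβ, hβ'⟩ : ∃ β, wSq i α β = w ^ 2 ∧
      2 * Real.pi / w * β / 2 = θ - angleShift i v := by
    cases i
    · refine ⟨c - p, by simp [wSq, hαdef, hwc], ?_⟩
      rw [hc, hp, angleShift]
      field_simp
    · refine ⟨c, by simp [wSq, hαdef, hwc], ?_⟩
      rw [hc, angleShift]
      field_simp
      simp
  have hsq : √(wSq i α β) = w := by rw [hβ, Real.sqrt_sq hw0.le]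
  have hwpos : 0 < wSq i α β := by rw [hβ]; positivity
  have hα1 : α 1 ^ 2 ≠ 1 := hp1.ne
  have hl := isLeast_conjugateTimes (i := i) (β := β) hα hα1 hwpos
  have hs := sinQuot_first (i := i) (β := β) hα hwpos
  have hph := phase_first (i := i) (β := β) hα hwpos
  rw [hsq] at hl hs hph
  refine ⟨α, β, 2 * Real.pi / w, hα, hl.isGLB, by positivity, ?_⟩
  have hB : compB i α β (2 * Real.pi / w) = 0 := by simp [compB, hs]
  have hA' : compA i α β (2 * Real.pi / w) = A := by
    rw [phase] at hph
    rw [compA, hs, hph, cosSqrt_sq, Real.cos_pi, hβ']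
    have : ((θ - angleShift i v : ℝ) : ℂ) * Complex.I =
        θ * Complex.I - angleShift i v * Complex.I := by push_cast; ring
    rw [this, Complex.exp_sub]
    have h2 := Complex.exp_ne_zero (angleShift i v * Complex.I)
    simp
    rw [← neg_div, ← hθA, mul_div_cancel_right₀ _ h2]
  have hv : 2 * Real.pi / w * α 1 = v := by
    simp only [hαdef, hp]
    simp
    field_simp
  rw [srExp_eq_elt, hA', hB, hv]

end Locus

end SU11R

open SU11R
theorem corollary1 :
    ∃ x : ℕ → ℝ, IsAscendingEnumeration {y : ℝ | 0 < y ∧ Real.tan y = y} x ∧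
      ∀ i : SRMetric,
        (∀ α ∈ unitSphere, ∀ β : ℝ, α 1 ≠ 1 → α 1 ≠ -1 →
          (0 < wSq i α β →
            ∃ T : ℕ → ℝ, IsAscendingEnumeration (conjugateTimes i α β) T ∧
              ∀ m : ℕ, T (2 * m) = 2 * Real.pi * (m + 1) / Real.sqrt (wSq i α β) ∧
                T (2 * m + 1) = 2 * x m / Real.sqrt (wSq i α β)) ∧
          (wSq i α β ≤ 0 → conjugateTimes i α β = ∅)) ∧
        firstConjugateLocus i = {g ∈ groupSU11R | ∃ (A : ℂ) (v : ℝ), ‖A‖ = 1 ∧ g = elt A 0 v} := by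
  refine ⟨tanRoot, isAscendingEnumeration_tanRoot, fun i => ⟨fun α hα β h1 h2 => ?_,
    (firstConjugateLocus_subset i).antisymm (subset_firstConjugateLocus i)⟩⟩
  have h : α 1 ^ 2 ≠ 1 := by simp [h1, h2]
  -- Enumerations start at `0`, so even indices carry the odd-numbered conjugate times.
  refine ⟨fun hw => ⟨_, isAscendingEnumeration_conjugateTimes hα h hw, fun m => ⟨?_, ?_⟩⟩,
    conjugateTimes_eq_empty hα h⟩
  · rw [alternatingRoot_two_mul, mul_comm ((m : ℝ) + 1), mul_assoc]
  · rw [alternatingRoot_two_mul_add_one]
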